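/- Let $\Omega\subset\mathbb R^3$ be a non-empty, bounded, connected open set with $C^2$ boundary. Let $\mu>0$, $3\lambda+2\mu>0$, $m=\min\{\mu,3\lambda+2\mu\}$, $\Delta^*=\mu\Delta+(\lambda+\mu)\nabla(\nabla\cdot)$, and let $T u=2\mu\,\mathbf n\cdot\nabla u+\lambda\,\mathbf n\,\nabla\cdot u+\mu\,\mathbf n\times\nabla\times u$ be the traction on $\partial\Omega$, where $\mathbf n$ is the outward unit normal. Let $\rho\in L^\infty(\Omega)$ be real and positive, let $\rho_*$ and $\rho^*$ be its (essential) infimum and supremum over $\Omega$, and assume that $\rho_*>1$ or $\rho^*<1$. Let $\lambda_1(\Omega)$ be the first Dirichlet eigenvalue of $-\Delta$ in $\Omega$, and let $\omega\in\mathbb R$, $\omega\neq0$, satisfy $$\omega^2<\min\Big\{\frac{m\,\lambda_1(\Omega)}{\rho^*},\; m\,\lambda_1(\Omega)\Big\}.$$ Let $\mathcal H(\Omega)=\{u\in (H^1(\Omega))^3 : \Delta^*u\in (L^2(\Omega))^3\}$ with norm $\|u\|_{\mathcal H(\Omega)}^2=\|u\|_{H^1(\Omega)}^2+\|\Delta^*u\|_{L^2(\Omega)}^2$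 (complex-valued fields), and for $u\in\mathcal H(\Omega)$ let $\gamma_0u=u|_{\partial\Omega}\in (H^{1/2}(\partial\Omega))^3$ and $\gamma_1u=Tu|_{\partial\Omega}\in (H^{-1/2}(\partial\Omega))^3$ be its traces, $\gamma_1$ being defined by Green's formula. Then there is a constant $C>0$, depending only on $\Omega,\lambda,\mu,\rho,\omega$, such that for all $f\in (H^{1/2}(\partial\Omega))^3$, $h\in (H^{-1/2}(\partial\Omega))^3$ and $u_0\in\mathcal H(\Omega)$ with $\gamma_0u_0=f$ and $\gamma_1u_0=h$, the interior transmission problem $$\Delta^*U+\omega^2\rho\,U=0,\qquad \Delta^*V+\omega^2V=0\quad\text{in }\Omega,$$ $$U-V=f,\qquad TU-TV=h\quad\text{on }\partial\Omega$$ (the equations hold in the sense of distributions; the boundary conditions mean that $U-V\in\mathcal H(\Omega)$, $\gamma_0(U-V)=f$ and $\gamma_1(U-V)=h$) has a unique solution $(U,V)\in (L^2(\Omega))^3\times (L^2(\Omega))^3$, and this solution satisfies $$\|U\|_{L^2(\Omega)}+\|V\|_{L^2(\Omega)}\le C\,\|u_0\|_{\mathcal H(\Omega)}.$$ -/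

import Mathlib

open MeasureTheory TopologicalSpace
open scoped Distributions LineDeriv ENNReal ComplexConjugate

noncomputable section

namespace Elastic

/-- Euclidean space `ℝ³`. -/
abbrev E3 : Type := EuclideanSpace ℝ (Fin 3)

/-- The `j`-th standard basis vector of `ℝ³`. -/
def e (j : Fin 3) : E3 := EuclideanSpace.single j 1

/-- `Ω` has a `C²` boundary: near each boundary point, `Ω` is the set where a `C²` function
with non-vanishing derivative is negative. -/
def HasC2Boundary (Ω : Opens E3) : Prop :=
  ∀ x ∈ frontier (Ω : Set E3), ∃ W : Set E3, IsOpen W ∧ x ∈ W ∧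
    ∃ ψ : E3 → ℝ, ContDiffOn ℝ 2 ψ W ∧ (∀ y ∈ W, fderiv ℝ ψ y ≠ 0) ∧
      ψ x = 0 ∧ ∀ y ∈ W, (y ∈ Ω ↔ ψ y < 0)

/-- The complex space `L²(Ω)`. -/
abbrev L2 (Ω : Opens E3) : Type := Lp ℂ 2 (volume.restrict (Ω : Set E3))

/-- The space `(L²(Ω))³`, with `‖u‖² = ∑ i, ‖u i‖²`. -/
abbrev L2v (Ω : Opens E3) : Type := PiLp 2 (fun _ : Fin 3 => L2 Ω)

variable {Ω : Opens E3}

/-- `v = ∂_j u` in the sense of distributions on `Ω`. -/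
def IsWeakPartial (j : Fin 3) (u v : L2 Ω) : Prop :=
  ∀ φ : 𝓓(Ω, ℂ), ∫ x in (Ω : Set E3), u x * (∂_{e j} φ) x = -∫ x in (Ω : Set E3), v x * φ x

lemma integrable_mul_test (u : L2 Ω) (φ : 𝓓(Ω, ℂ)) :
    Integrable (fun x => u x * φ x) (volume.restrict (Ω : Set E3)) := by
  have h2 : MemLp (φ : E3 → ℂ) 2 (volume.restrict (Ω : Set E3)) :=
    (φ.continuous.memLp_of_hasCompactSupport φ.hasCompactSupport).restrict _
  exact (Lp.memLp u).integrable_mul h2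

lemma integral_add_mul_test (u v : L2 Ω) (φ : 𝓓(Ω, ℂ)) :
    ∫ x in (Ω : Set E3), (u + v) x * φ x =
      (∫ x in (Ω : Set E3), u x * φ x) + ∫ x in (Ω : Set E3), v x * φ x := by
  rw [← integral_add (integrable_mul_test u φ) (integrable_mul_test v φ)]
  refine integral_congr_ae ?_
  filter_upwards [Lp.coeFn_add u v] with x hx
  simp only [hx, Pi.add_apply, add_mul]

lemma integral_smul_mul_test (c : ℂ) (u : L2 Ω) (φ : 𝓓(Ω, ℂ)) :
    ∫ x in (Ω : Set E3), (c • u) x * φ x = c * ∫ x in (Ω : Set E3), u x * φ x := by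
  rw [← integral_const_mul]
  refine integral_congr_ae ?_
  filter_upwards [Lp.coeFn_smul c u] with x hx
  simp only [hx, Pi.smul_apply, smul_eq_mul, mul_assoc]

lemma integral_zero_mul_test (φ : 𝓓(Ω, ℂ)) :
    ∫ x in (Ω : Set E3), (0 : L2 Ω) x * φ x = 0 := by
  simpa using integral_smul_mul_test 0 (0 : L2 Ω) φ

/-- The Sobolev space `H¹(Ω)`, realised as the space of pairs `(u, ∇u)` of an `L²` function and its
weak gradient in `(L²)³` (the gradient is determined by `u`). The norm inherited from the product is
`‖u‖² = ‖u‖²_{L²} + ∑ j, ‖∂_j u‖²_{L²}`. -/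
def H1 (Ω : Opens E3) : Submodule ℂ (WithLp 2 (L2 Ω × L2v Ω)) where
  carrier := {p | ∀ j, IsWeakPartial j p.fst (p.snd j)}
  zero_mem' := by
    intro j φ
    simp only [WithLp.zero_fst, WithLp.zero_snd, PiLp.zero_apply]
    rw [integral_zero_mul_test, integral_zero_mul_test, neg_zero]
  add_mem' := by
    intro p q hp hq j φ
    simp only [WithLp.add_fst, WithLp.add_snd, PiLp.add_apply]
    rw [integral_add_mul_test, integral_add_mul_test, hp j φ, hq j φ, neg_add]
  smul_mem' := by
    intro c p hp j φ
    simp only [WithLp.smul_fst, WithLp.smul_snd, PiLp.smul_apply]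
    rw [integral_smul_mul_test, integral_smul_mul_test, hp j φ, mul_neg]

/-- The underlying `L²` function of an element of `H¹(Ω)`. -/
def H1.fn : H1 Ω →L[ℂ] L2 Ω :=
  (WithLp.fstL 2 ℂ (L2 Ω) (L2v Ω)).comp (H1 Ω).subtypeL

/-- The weak partial derivative `∂_j u ∈ L²(Ω)` of `u ∈ H¹(Ω)`. -/
def H1.pd (j : Fin 3) : H1 Ω →L[ℂ] L2 Ω :=
  (PiLp.proj 2 (𝕜 := ℂ) (fun _ : Fin 3 => L2 Ω) j).comp
    ((WithLp.sndL 2 ℂ (L2 Ω) (L2v Ω)).comp (H1 Ω).subtypeL)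

/-- The element `u` of `H¹(Ω)` is the test function `φ`. -/
def H1.IsTest (u : H1 Ω) (φ : 𝓓(Ω, ℂ)) : Prop :=
  H1.fn u =ᵐ[volume.restrict (Ω : Set E3)] φ ∧
    ∀ j, H1.pd j u =ᵐ[volume.restrict (Ω : Set E3)] (∂_{e j} φ : 𝓓(Ω, ℂ))

/-- `H¹₀(Ω)`, the closure of the test functions in `H¹(Ω)`. -/
def H10 (Ω : Opens E3) : Submodule ℂ (H1 Ω) :=
  (Submodule.span ℂ {u : H1 Ω | ∃ φ : 𝓓(Ω, ℂ), H1.IsTest u φ}).topologicalClosure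

/-- The first Dirichlet eigenvalue of `-Δ` in `Ω`: the minimum of the Rayleigh quotient
`‖∇u‖² / ‖u‖²` over the nonzero `u ∈ H¹₀(Ω)`. -/
def dirichletEigenvalue (Ω : Opens E3) : ℝ :=
  sInf {r : ℝ | ∃ u ∈ H10 Ω, H1.fn u ≠ 0 ∧
    r = (∑ j, ‖H1.pd j u‖ ^ 2) / ‖H1.fn u‖ ^ 2}

/-- The space `(H¹(Ω))³`. -/
abbrev H1v (Ω : Opens E3) : Type := PiLp 2 (fun _ : Fin 3 => H1 Ω)

/-- The underlying `L²` field of an element of `(H¹(Ω))³`. -/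
def H1v.fn (u : H1v Ω) : L2v Ω := WithLp.toLp 2 fun i => H1.fn (u i)

/-- The Lamé operator `Δ* φ = μ Δ φ + (λ + μ) ∇ (∇ · φ)` on (complex) vector test functions,
`i`-th component. -/
def lameTest (lam mu : ℝ) (φ : Fin 3 → 𝓓(Ω, ℂ)) (i : Fin 3) : 𝓓(Ω, ℂ) :=
  mu • (∑ j, ∂_{e j} (∂_{e j} (φ i))) + (lam + mu) • ∑ j, ∂_{e i} (∂_{e j} (φ j))

/-- `Δ* u = g` in `Ω` in the sense of distributions. -/
def IsWeakLame (lam mu : ℝ) (u : L2v Ω) (g : Fin 3 → E3 → ℂ) : Prop :=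
  ∀ φ : Fin 3 → 𝓓(Ω, ℂ),
    ∑ i, ∫ x in (Ω : Set E3), u i x * lameTest lam mu φ i x =
      ∑ i, ∫ x in (Ω : Set E3), g i x * φ i x

/-- The space `ℋ(Ω) = {u ∈ (H¹(Ω))³ | Δ* u ∈ (L²(Ω))³}`, realised as the space of pairs
`(u, Δ* u)`, with norm `‖u‖² = ‖u‖²_{H¹} + ‖Δ* u‖²_{L²}`. -/
def HLame (Ω : Opens E3) (lam mu : ℝ) : Submodule ℂ (WithLp 2 (H1v Ω × L2v Ω)) where
  carrier := {p | IsWeakLame lam mu (H1v.fn p.fst) (fun i => p.snd i)}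
  zero_mem' := by
    intro φ
    simp only [H1v.fn, WithLp.zero_fst, WithLp.zero_snd, PiLp.zero_apply, map_zero]
    simp only [integral_zero_mul_test]
  add_mem' := by
    intro p q hp hq φ
    have h1 := hp φ
    have h2 := hq φ
    simp only [H1v.fn, WithLp.add_fst, WithLp.add_snd, PiLp.add_apply, map_add] at h1 h2 ⊢
    simp only [integral_add_mul_test, Finset.sum_add_distrib, h1, h2]
  smul_mem' := by
    intro c p hp φ
    have h1 := hp φ
    simp only [H1v.fn, WithLp.smul_fst, WithLp.smul_snd, PiLp.smul_apply, map_smul] at h1 ⊢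
    simp only [integral_smul_mul_test, ← Finset.mul_sum, h1]

variable {lam mu : ℝ}

/-- The `(H¹(Ω))³` field underlying an element of `ℋ(Ω)`. -/
def HLame.toH1v (u : HLame Ω lam mu) : H1v Ω := (u : WithLp 2 (H1v Ω × L2v Ω)).fst

/-- `Δ* u ∈ (L²(Ω))³` for `u ∈ ℋ(Ω)`. -/
def HLame.lame (u : HLame Ω lam mu) : L2v Ω := (u : WithLp 2 (H1v Ω × L2v Ω)).snd

/-- The stress tensor `σ(u) = λ (∇ · u) I + μ (∇u + (∇u)ᵀ)` of `u ∈ (H¹(Ω))³`. -/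
def stress (lam mu : ℝ) (u : H1v Ω) (i j : Fin 3) : L2 Ω :=
  (if i = j then (lam : ℂ) • ∑ k, H1.pd k (u k) else 0) +
    (mu : ℂ) • (H1.pd j (u i) + H1.pd i (u j))

/-- The trace space `H^{1/2}(∂Ω)`: the space of boundary values of `H¹(Ω)`, where two functions have
the same boundary values iff their difference lies in `H¹₀(Ω)`; with the quotient norm. -/
abbrev HHalf (Ω : Opens E3) : Type := H1 Ω ⧸ H10 Ω

/-- The space `H^{-1/2}(∂Ω)`: the (anti-)dual of `H^{1/2}(∂Ω)`. -/
abbrev HMinusHalf (Ω : Opens E3) : Type := HHalf Ω →L⋆[ℂ] ℂ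

/-- The trace `γ₀ u = u|_{∂Ω} ∈ (H^{1/2}(∂Ω))³`. -/
def trace0 (u : H1v Ω) : Fin 3 → HHalf Ω := fun i => (H10 Ω).mkQ (u i)

/-- The functional `φ ↦ ∫_Ω ∑_j σ(u)_{ij} conj(∂_j φ) + (Δ* u)_i conj φ` on `H¹(Ω)`; by Green's
formula it is the `i`-th component of `φ ↦ ∫_{∂Ω} (T u) conj φ ds`. -/
def greenForm (u : HLame Ω lam mu) (i : Fin 3) : H1 Ω →L⋆[ℂ] ℂ :=
  (∑ j, (innerSLFlip ℂ (stress lam mu (HLame.toH1v u) i j)).comp (H1.pd j)) +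
    (innerSLFlip ℂ (HLame.lame u i)).comp H1.fn

/-- The complex conjugate of a test function. -/
def conjTest (φ : 𝓓(Ω, ℂ)) : 𝓓(Ω, ℂ) where
  toFun x := conj (φ x)
  contDiff' := Complex.conjCLE.contDiff.comp φ.contDiff
  hasCompactSupport' := φ.hasCompactSupport.comp_left (g := conj) (map_zero _)
  tsupport_subset' := (tsupport_comp_subset (g := conj) (map_zero _) φ).trans φ.tsupport_subset

lemma lineDeriv_test_apply (φ : 𝓓(Ω, ℂ)) (v : E3) (x : E3) :
    (∂_{v} φ : 𝓓(Ω, ℂ)) x = fderiv ℝ φ x v := by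
  rw [TestFunction.lineDerivOp_eq_lineDerivCLM ℝ, TestFunction.lineDerivCLM_eq_fderivCLM,
    TestFunction.fderivCLM_apply_of_le _ (by simp)]

lemma conjTest_apply (φ : 𝓓(Ω, ℂ)) (x : E3) : conjTest φ x = conj (φ x) := rfl

lemma lineDeriv_conjTest (φ : 𝓓(Ω, ℂ)) (v : E3) :
    (∂_{v} (conjTest φ) : 𝓓(Ω, ℂ)) = conjTest (∂_{v} φ) := by
  ext x
  rw [conjTest_apply, lineDeriv_test_apply, lineDeriv_test_apply]
  have hd : DifferentiableAt ℝ φ x := (φ.contDiff.differentiable (by simp)) x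
  have h := (Complex.conjCLE.hasFDerivAt (x := φ x)).comp x hd.hasFDerivAt
  have h' : HasFDerivAt (conjTest φ) _ x := h
  rw [h'.fderiv]
  simp

lemma lineDeriv_comm_test (φ : 𝓓(Ω, ℂ)) (v w : E3) :
    (∂_{v} (∂_{w} φ : 𝓓(Ω, ℂ)) : 𝓓(Ω, ℂ)) = ∂_{w} (∂_{v} φ : 𝓓(Ω, ℂ)) := by
  ext x
  have hφ : ContDiff ℝ 2 φ := φ.contDiff.of_le (WithTop.coe_le_coe.2 le_top)
  have hd : DifferentiableAt ℝ (fderiv ℝ φ) x :=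
    (hφ.fderiv_right (m := 1) (by norm_num)).differentiable (by simp) x
  have aux : ∀ a b : E3, (∂_{a} (∂_{b} φ : 𝓓(Ω, ℂ)) : 𝓓(Ω, ℂ)) x =
      fderiv ℝ (fderiv ℝ φ) x a b := by
    intro a b
    have hb : ((∂_{b} φ : 𝓓(Ω, ℂ)) : E3 → ℂ) = fun y => fderiv ℝ φ y b := by
      ext y; exact lineDeriv_test_apply φ b y
    rw [lineDeriv_test_apply, hb, fderiv_clm_apply hd (differentiableAt_const b)]
    simp
  rw [aux, aux]
  exact (hφ.contDiffAt.isSymmSndFDerivAt (by simp)) v w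

lemma integral_mul_test_add (u : L2 Ω) (φ χ : 𝓓(Ω, ℂ)) :
    ∫ x in (Ω : Set E3), u x * (φ + χ) x =
      (∫ x in (Ω : Set E3), u x * φ x) + ∫ x in (Ω : Set E3), u x * χ x := by
  rw [← integral_add (integrable_mul_test u φ) (integrable_mul_test u χ)]
  simp [mul_add]

lemma integral_mul_test_smul (c : ℝ) (u : L2 Ω) (φ : 𝓓(Ω, ℂ)) :
    ∫ x in (Ω : Set E3), u x * (c • φ) x = c * ∫ x in (Ω : Set E3), u x * φ x := by
  rw [← integral_const_mul]
  refine integral_congr_ae (.of_forall fun x => ?_)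
  simp; ring

/-- The bilinear pairing `∫_Ω u φ`. -/
def pairing : L2 Ω →ₗ[ℂ] 𝓓(Ω, ℂ) →ₗ[ℝ] ℂ :=
  LinearMap.mk₂' ℂ ℝ (fun u φ => ∫ x in (Ω : Set E3), u x * φ x) integral_add_mul_test
    integral_smul_mul_test integral_mul_test_add
    (fun c u φ => by simpa using integral_mul_test_smul c u φ)

lemma inner_test (u : H1 Ω) (φ : 𝓓(Ω, ℂ)) (h : H1.IsTest u φ) (w : L2 Ω) :
    inner ℂ (H1.fn u) w = pairing w (conjTest φ) := by
  rw [L2.inner_def]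
  refine integral_congr_ae ?_
  filter_upwards [h.1] with x hx
  simp [hx, conjTest_apply]

lemma inner_pd_test (u : H1 Ω) (φ : 𝓓(Ω, ℂ)) (h : H1.IsTest u φ) (w : L2 Ω) (j : Fin 3) :
    inner ℂ (H1.pd j u) w = pairing w (∂_{e j} (conjTest φ)) := by
  rw [L2.inner_def, lineDeriv_conjTest]
  refine integral_congr_ae ?_
  filter_upwards [h.2 j] with x hx
  simp [hx, conjTest_apply]

lemma pairing_lineDeriv (u : H1 Ω) (j : Fin 3) (φ : 𝓓(Ω, ℂ)) :
    pairing (H1.fn u) (∂_{e j} φ) = - pairing (H1.pd j u) φ := u.2 j φ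

lemma greenForm_test (u : HLame Ω lam mu) (i : Fin 3) (w : H1 Ω) (φ : 𝓓(Ω, ℂ))
    (h : H1.IsTest w φ) : greenForm u i w = 0 := by
  have key : ∀ Φ : Fin 3 → 𝓓(Ω, ℂ), 
      ∑ k, pairing (H1.fn (HLame.toH1v u k)) (lameTest lam mu Φ k) = 
        ∑ k, pairing (HLame.lame u k) (Φ k) := u.2
  have h1 := key (Pi.single i (conjTest φ))
  have h2 : ∀ j : Fin 3, pairing (H1.pd i (HLame.toH1v u j)) (∂_{e j} (conjTest φ)) =
      pairing (H1.pd j (HLame.toH1v u j)) (∂_{e i} (conjTest φ)) := by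
    intro j
    rw [← neg_inj, ← pairing_lineDeriv, ← pairing_lineDeriv, lineDeriv_comm_test]
  have h3 : ∑ k, pairing (HLame.lame u k) ((Pi.single i (conjTest φ) : Fin 3 → 𝓓(Ω, ℂ)) k) =
      pairing (HLame.lame u i) (conjTest φ) := by
    rw [Finset.sum_eq_single i (fun k _ hk => by simp [Pi.single_eq_of_ne hk]) (by simp)]
    simp
  have h4 : greenForm u i w =
      (∑ j, pairing (stress lam mu (HLame.toH1v u) i j) (∂_{e j} (conjTest φ))) +
        pairing (HLame.lame u i) (conjTest φ) := by
    simp only [greenForm, add_apply, sum_apply,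
      ContinuousLinearMap.comp_apply, innerSLFlip_apply_apply, inner_test w φ h,
      inner_pd_test w φ h]
  have h5 : ∀ k j : Fin 3, (∂_{e j} ((Pi.single i (conjTest φ) : Fin 3 → 𝓓(Ω, ℂ)) k) : 𝓓(Ω, ℂ)) =
      if k = i then ∂_{e j} (conjTest φ) else 0 := by
    intro k j
    rcases eq_or_ne k i with rfl | hk
    · simp
    · rw [Pi.single_eq_of_ne hk, if_neg hk, TestFunction.lineDerivOp_eq_lineDerivCLM ℝ, map_zero]
  rw [h4, ← h3, ← h1]
  have h6 : ∀ k, pairing (H1.fn (HLame.toH1v u k)) (lameTest lam mu (Pi.single i (conjTest φ)) k) =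
      -(mu * ∑ j, if k = i then pairing (H1.pd j (HLame.toH1v u k)) (∂_{e j} (conjTest φ)) else 0)
      - (lam + mu) * pairing (H1.pd k (HLame.toH1v u k)) (∂_{e i} (conjTest φ)) := by
    intro k
    have hs : ∀ v : L2 Ω, ∑ j, -pairing v (if j = i then ∂_{e j} (conjTest φ) else 0) =
        -pairing v (∂_{e i} (conjTest φ)) := by
      intro v
      rw [Finset.sum_eq_single i (fun j _ hj => by simp [hj]) (by simp), if_pos rfl]
    simp only [lameTest, map_add, map_smul, map_sum, pairing_lineDeriv, h5, hs]
    by_cases hk : k = i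
    · simp only [hk, if_true, Complex.real_smul, Complex.ofReal_add, Finset.sum_neg_distrib]
      ring
    · simp only [hk, if_false, map_zero, neg_zero, Finset.sum_const_zero, smul_zero,
        mul_zero, Complex.real_smul, Complex.ofReal_add]
      ring
  have h7 : ∀ j, pairing (stress lam mu (HLame.toH1v u) i j) (∂_{e j} (conjTest φ)) =
      (if i = j then lam * ∑ k, pairing (H1.pd k (HLame.toH1v u k)) (∂_{e j} (conjTest φ)) else 0) +
      mu * (pairing (H1.pd j (HLame.toH1v u i)) (∂_{e j} (conjTest φ)) +
        pairing (H1.pd j (HLame.toH1v u j)) (∂_{e i} (conjTest φ))) := by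
    intro j
    rw [← h2 j]
    unfold stress
    split_ifs <;> simp [Finset.mul_sum, mul_add]
  simp only [h6, h7, Finset.sum_add_distrib, Finset.sum_sub_distrib, Finset.sum_neg_distrib,
    ← Finset.mul_sum, Finset.sum_ite_eq, Finset.mem_univ, if_true]
  rw [Finset.sum_eq_single i (f := fun k => ∑ j, if k = i then
    pairing (H1.pd j (HLame.toH1v u k)) (∂_{e j} (conjTest φ)) else 0)
    (fun j _ hj => by simp [hj]) (by simp)]
  simp only [if_true]
  ring

lemma H10_le_ker_greenForm (u : HLame Ω lam mu) (i : Fin 3) : H10 Ω ≤ (greenForm u i).ker := by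
  refine Submodule.topologicalClosure_minimal _ (Submodule.span_le.2 ?_) (greenForm u i).isClosed_ker
  rintro w ⟨φ, h⟩
  exact greenForm_test u i w φ h

/-- The conormal trace `γ₁ u = T u|_{∂Ω} ∈ (H^{-1/2}(∂Ω))³` of `u ∈ ℋ(Ω)`, where
`T = 2 μ n · grad + λ n div + μ n × curl` is the traction operator (so `T u = σ(u) n`), defined by
Green's formula `⟨γ₁ u, γ₀ φ⟩ = ∫_Ω σ(u) : conj ∇φ + Δ* u · conj φ`. -/
def trace1 (u : HLame Ω lam mu) : Fin 3 → HMinusHalf Ω := fun i =>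
  (H10 Ω).liftQL (greenForm u i) (H10_le_ker_greenForm u i)

/-- `(U, V) ∈ (L²(Ω))³ × (L²(Ω))³` solves the interior transmission problem
`Δ* U + ω² ρ U = 0` and `Δ* V + ω² V = 0` in `Ω` (in the sense of distributions),
`U - V = f` and `T U - T V = h` on `∂Ω` (`U - V` lies in `ℋ(Ω)` and has the traces `f` and `h`). -/
structure IsITPSolution (Ω : Opens E3) (lam mu ω : ℝ) (ρ : E3 → ℝ)
    (f : Fin 3 → HHalf Ω) (h : Fin 3 → HMinusHalf Ω) (U V : L2v Ω) : Prop where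
  eqU : IsWeakLame lam mu U (fun i x => -(ω ^ 2 * ρ x : ℝ) * U i x)
  eqV : IsWeakLame lam mu V (fun i x => -(ω ^ 2 : ℝ) * V i x)
  boundary : ∃ u : HLame Ω lam mu, H1v.fn (HLame.toH1v u) = U - V ∧
    trace0 (HLame.toH1v u) = f ∧ trace1 u = h

end Elastic

end

/-!
Let `w = U - V` and `s = ω²`, and let `L = Δ*`. Subtracting the two equations expresses `U` through
`w`: `(L + s) w = -s (ρ - 1) U`, where `ρ - 1` is bounded away from zero. The equation for `V` then
becomes a fourth order equation for `w`,
`(L + s) ((ρ - 1)⁻¹ (L + s) + s) w = 0`,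
whose weak form is a sesquilinear form on the fields with vanishing Cauchy data. The contrast
condition makes `(ρ - 1)⁻¹` definite; a Korn type inequality `-⟪L w, w⟫ ≥ m ‖∇w‖²` and Poincaré's
inequality then make the form coercive below the stated frequency, and the Lax–Milgram theorem
solves the problem.

Since the equations are tested only against smooth compactly supported fields, this needs their
density among the fields with vanishing Cauchy data, in the norm of `ℋ(Ω)`. Such a field extends by
zero to `ℝ³` with a square integrable `Δ*`; after a partition of unity each piece is translated
into `Ω` along the segment property of the boundary and mollified.
-/

noncomputable section

namespace Elastic

section Mollification

open Filter Topology ContDiff Convolution ContinuousLinearMap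

variable {E G : Type*} [NormedAddCommGroup E] [MeasurableSpace E] [NormedAddCommGroup G]

lemma tendsto_eLpNorm_comp_sub_right_sub [NormedSpace ℝ E] [FiniteDimensional ℝ E] [BorelSpace E]
    {μ : Measure E} [μ.IsAddHaarMeasure] {p : ℝ≥0∞} [Fact (1 ≤ p)] (hp : p ≠ ⊤) {w : E → G}
    (hw : MemLp w p μ) :
    Tendsto (fun y => eLpNorm (fun x => w (x - y) - w x) p μ) (𝓝 0) (𝓝 0) := by
  have : Fact (p ≠ ⊤) := ⟨hp⟩
  have hcont : Continuous fun y : E => DomAddAct.mk (-y) +ᵥ hw.toLp w :=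
    (DomAddAct.continuous_mk.comp continuous_neg).vadd continuous_const
  have hlim := hcont.tendsto 0
  simp only [neg_zero, DomAddAct.mk_zero, zero_vadd] at hlim
  refine (tendsto_iff_edist_tendsto_0.1 hlim).congr fun y => ?_
  rw [DomAddAct.mk_vadd_toLp, Lp.edist_toLp_toLp]
  refine eLpNorm_congr_ae (.of_forall fun x => ?_)
  simp [sub_eq_neg_add]

lemma eLpNorm_integral_le_of_ae_le [NormedSpace ℝ G] {X S : Type*} [MeasurableSpace X]
    [MeasurableSpace S] {μ : Measure X} [SFinite μ] {ν : Measure S} [IsProbabilityMeasure ν]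
    {p : ℝ≥0∞} (hp : 1 ≤ p) (hp' : p ≠ ⊤) {f : X → S → G}
    (hf : StronglyMeasurable (Function.uncurry f)) {ε : ℝ≥0∞}
    (hε : ∀ᵐ s ∂ν, eLpNorm (fun x => f x s) p μ ≤ ε) :
    eLpNorm (fun x => ∫ s, f x s ∂ν) p μ ≤ ε := by
  have hp0 : p ≠ 0 := (one_pos.trans_le hp).ne'
  have hpos : 0 < p.toReal := ENNReal.toReal_pos hp0 hp'
  have jensen (x : X) : ‖∫ s, f x s ∂ν‖ₑ ^ p.toReal ≤ ∫⁻ s, ‖f x s‖ₑ ^ p.toReal ∂ν := by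
    have hx : StronglyMeasurable (f x) := hf.comp_measurable measurable_prodMk_left
    rw [← ENNReal.le_rpow_inv_iff hpos, ← one_div,
      ← eLpNorm_eq_lintegral_rpow_enorm_toReal hp0 hp']
    calc ‖∫ s, f x s ∂ν‖ₑ ≤ ∫⁻ s, ‖f x s‖ₑ ∂ν := enorm_integral_le_lintegral_enorm _
      _ = eLpNorm (f x) 1 ν := eLpNorm_one_eq_lintegral_enorm.symm
      _ ≤ eLpNorm (f x) p ν :=
        eLpNorm_le_eLpNorm_of_exponent_le hp hx.aestronglyMeasurable
  rw [eLpNorm_eq_lintegral_rpow_enorm_toReal hp0 hp', one_div, ENNReal.rpow_inv_le_iff hpos]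
  calc ∫⁻ x, ‖∫ s, f x s ∂ν‖ₑ ^ p.toReal ∂μ
      ≤ ∫⁻ x, ∫⁻ s, ‖f x s‖ₑ ^ p.toReal ∂ν ∂μ := lintegral_mono jensen
    _ = ∫⁻ s, ∫⁻ x, ‖f x s‖ₑ ^ p.toReal ∂μ ∂ν :=
        lintegral_lintegral_swap (hf.enorm.pow_const _).aemeasurable
    _ ≤ ∫⁻ _, ε ^ p.toReal ∂ν := by
        refine lintegral_mono_ae (hε.mono fun s hs => ?_)
        rwa [← ENNReal.rpow_inv_le_iff hpos, ← one_div,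
          ← eLpNorm_eq_lintegral_rpow_enorm_toReal hp0 hp']
    _ = ε ^ p.toReal := by simp

variable [NormedSpace ℝ E] [NormedSpace ℝ G]

section
variable [HasContDiffBump E]

/-- The mollification of `w` by the normed bump function `η`, as a convolution. -/
def mollify (η : ContDiffBump (0 : E)) (μ : Measure E) (w : E → G) : E → G :=
  w ⋆[(lsmul ℝ ℝ).flip, μ] η.normed μ

lemma mollify_zero (η : ContDiffBump (0 : E)) (μ : Measure E) :
    mollify η μ (0 : E → G) = 0 :=
  zero_convolution

lemma mollify_const_smul (η : ContDiffBump (0 : E)) (μ : Measure E) (c : ℝ) (w : E → G) :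
    mollify η μ (c • w) = c • mollify η μ w :=
  smul_convolution
end

variable [FiniteDimensional ℝ E] [BorelSpace E] {μ : Measure E} [μ.IsAddHaarMeasure]

lemma mollify_add (η : ContDiffBump (0 : E)) {f g : E → G} (hf : LocallyIntegrable f μ)
    (hg : LocallyIntegrable g μ) : mollify η μ (f + g) = mollify η μ f + mollify η μ g :=
  ConvolutionExists.add_distrib
    (η.hasCompactSupport_normed.convolutionExists_right _ hf η.continuous_normed)
    (η.hasCompactSupport_normed.convolutionExists_right _ hg η.continuous_normed)

lemma mollify_sum (η : ContDiffBump (0 : E)) {κ : Type*} (s : Finset κ) {f : κ → E → G}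
    (hf : ∀ k, LocallyIntegrable (f k) μ) :
    mollify η μ (∑ k ∈ s, f k) = ∑ k ∈ s, mollify η μ (f k) := by
  classical
  induction s using Finset.induction_on with
  | empty => exact mollify_zero η μ
  | insert a s ha ih =>
    simp only [Finset.sum_insert ha,
      mollify_add η (hf a) (locallyIntegrable_finsetSum' s fun k _ => hf k), ih]

lemma contDiff_mollify (η : ContDiffBump (0 : E)) {w : E → G} (hw : LocallyIntegrable w μ) :
    ContDiff ℝ ∞ (mollify η μ w) :=
  η.hasCompactSupport_normed.contDiff_convolution_right _ hw η.contDiff_normed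

lemma fderiv_mollify_apply (η : ContDiffBump (0 : E)) {w : E → G} (hw : LocallyIntegrable w μ)
    (x v : E) :
    fderiv ℝ (mollify η μ w) x v = ∫ t, fderiv ℝ (η.normed μ) (x - t) v • w t ∂μ := by
  have hη : ContDiff ℝ 1 (η.normed μ) := η.contDiff_normed
  rw [mollify, (η.hasCompactSupport_normed.hasFDerivAt_convolution_right _ hw hη x).fderiv,
    convolution_precompR_apply _ hw (η.hasCompactSupport_normed.fderiv ℝ)
      (hη.continuous_fderiv one_ne_zero)]
  rfl

lemma tsupport_mollify_subset (η : ContDiffBump (0 : E)) {w : E → G} {K : Set E}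
    (hw : ∀ x ∉ K, w x = 0) : tsupport (mollify η μ w) ⊆ Metric.cthickening η.rOut K := by
  refine closure_minimal (fun x hx => ?_) Metric.isClosed_cthickening
  obtain ⟨a, ha, b, hb, rfl⟩ := support_convolution_subset _ hx
  rw [η.support_normed_eq, mem_ball_zero_iff] at hb
  refine Metric.mem_cthickening_of_dist_le _ a _ _ (not_imp_comm.1 (hw a) ha) ?_
  simpa [dist_eq_norm] using hb.le

lemma mollify_sub_eq_integral_withDensity [CompleteSpace G] (η : ContDiffBump (0 : E)) {w : E → G}
    (hw : LocallyIntegrable w μ) (x : E) :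
    mollify η μ w x - w x =
      ∫ s, (w (x - s) - w x) ∂μ.withDensity fun s => ENNReal.ofReal (η.normed μ s) := by
  have h_int : Integrable (fun s => η.normed μ s • w (x - s)) μ :=
    (η.hasCompactSupport_normed.convolutionExists_left (lsmul ℝ ℝ) η.continuous_normed hw x)
  rw [integral_withDensity_eq_integral_toReal_smul
    η.continuous_normed.measurable.ennreal_ofReal (.of_forall fun _ => ENNReal.ofReal_lt_top)]
  simp only [ENNReal.toReal_ofReal (η.nonneg_normed _), smul_sub]
  rw [integral_sub h_int (η.integrable_normed.smul_const _), η.integral_normed_smul, mollify,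
    convolution_eq_swap]
  rfl

lemma eLpNorm_mollify_sub_le [CompleteSpace G] {p : ℝ≥0∞} (hp : 1 ≤ p) (hp' : p ≠ ⊤)
    (η : ContDiffBump (0 : E)) {w : E → G} (hm : StronglyMeasurable w) (hw : MemLp w p μ)
    {ε : ℝ≥0∞} (hε : ∀ y, ‖y‖ < η.rOut → eLpNorm (fun x => w (x - y) - w x) p μ ≤ ε) :
    eLpNorm (mollify η μ w - w) p μ ≤ ε := by
  have hk : Measurable fun s => ENNReal.ofReal (η.normed μ s) :=
    η.continuous_normed.measurable.ennreal_ofReal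
  have hprob : IsProbabilityMeasure (μ.withDensity fun s => ENNReal.ofReal (η.normed μ s)) := by
    refine ⟨?_⟩
    rw [withDensity_apply _ .univ, Measure.restrict_univ, ← ofReal_integral_eq_lintegral_ofReal
      η.integrable_normed (.of_forall η.nonneg_normed), η.integral_normed, ENNReal.ofReal_one]
  have hloc : LocallyIntegrable w μ := hw.locallyIntegrable hp
  rw [show mollify η μ w - w = fun x => _ from
    funext fun x => mollify_sub_eq_integral_withDensity η hloc x]
  refine eLpNorm_integral_le_of_ae_le hp hp' (f := fun x s => w (x - s) - w x) ?_ ?_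
  · exact (hm.comp_measurable (measurable_fst.sub measurable_snd)).sub
      (hm.comp_measurable measurable_fst)
  · rw [ae_withDensity_iff hk]
    refine .of_forall fun s hs => hε s ?_
    rw [← mem_ball_zero_iff, ← η.support_normed_eq (μ := μ)]
    rintro h
    simp [h] at hs

end Mollification

section PartialDerivative

open ContDiff

variable {ι G : Type*} [DecidableEq ι] [NormedAddCommGroup G] [NormedSpace ℝ G]
  {f : EuclideanSpace ℝ ι → G}

/-- The `j`-th partial derivative of a function on `ℝᵈ`. -/
def pderiv (j : ι) (f : EuclideanSpace ℝ ι → G) (x : EuclideanSpace ℝ ι) : G :=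
  fderiv ℝ f x (EuclideanSpace.single j 1)

lemma tsupport_pderiv_subset (f : EuclideanSpace ℝ ι → G) (j : ι) :
    tsupport (pderiv j f) ⊆ tsupport f :=
  tsupport_fderiv_apply_subset ℝ _

lemma hasCompactSupport_pderiv (hf : HasCompactSupport f) (j : ι) :
    HasCompactSupport (pderiv j f) :=
  hf.fderiv_apply ℝ _

variable [Fintype ι]

lemma contDiff_pderiv (hf : ContDiff ℝ ∞ f) (j : ι) : ContDiff ℝ ∞ (pderiv j f) :=
  (hf.fderiv_right (m := ∞) (by simp)).clm_apply contDiff_const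

lemma pderiv_mul {η φ : EuclideanSpace ℝ ι → ℝ} (hη : ContDiff ℝ ∞ η) (hφ : ContDiff ℝ ∞ φ)
    (j : ι) (x : EuclideanSpace ℝ ι) :
    pderiv j (η * φ) x = pderiv j η x * φ x + η x * pderiv j φ x := by
  unfold pderiv
  rw [fderiv_mul (hη.differentiable (by simp) x) (hφ.differentiable (by simp) x)]
  simp only [add_apply, smul_apply, smul_eq_mul]
  ring

end PartialDerivative

section WeakDivergence

open ContDiff

variable {ι G : Type*} [Fintype ι] [NormedAddCommGroup G]
  {S T : Set (EuclideanSpace ℝ ι)} {f g : EuclideanSpace ℝ ι → G} {η : EuclideanSpace ℝ ι → ℝ}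

/-- A square integrable function on `ℝᵈ` vanishing off `S`: the form in which functions on `S` are
extended by zero. -/
structure IsL2Off (S : Set (EuclideanSpace ℝ ι)) (f : EuclideanSpace ℝ ι → G) : Prop where
  stronglyMeasurable : StronglyMeasurable f
  memLp : MemLp f 2 volume
  eq_zero : ∀ x ∉ S, f x = 0

namespace IsL2Off

protected lemma zero : IsL2Off S (0 : EuclideanSpace ℝ ι → G) :=
  ⟨stronglyMeasurable_zero, MemLp.zero, fun _ _ => rfl⟩

protected lemma add (hf : IsL2Off S f) (hg : IsL2Off S g) : IsL2Off S (f + g) :=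
  ⟨hf.stronglyMeasurable.add hg.stronglyMeasurable, hf.memLp.add hg.memLp,
    fun x hx => by simp [hf.eq_zero x hx, hg.eq_zero x hx]⟩

protected lemma sum {κ : Type*} (s : Finset κ) {f : κ → EuclideanSpace ℝ ι → G}
    (hf : ∀ k, IsL2Off S (f k)) : IsL2Off S (∑ k ∈ s, f k) :=
  Finset.sum_induction _ _ (fun _ _ => IsL2Off.add) .zero fun k _ => hf k

lemma mono (hST : S ⊆ T) (hf : IsL2Off S f) : IsL2Off T f :=
  ⟨hf.stronglyMeasurable, hf.memLp, fun x hx => hf.eq_zero x (Set.notMem_subset hST hx)⟩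

lemma locallyIntegrable (hf : IsL2Off S f) : LocallyIntegrable f volume :=
  hf.memLp.locallyIntegrable one_le_two

lemma translate (hf : IsL2Off S f) (v : EuclideanSpace ℝ ι) :
    IsL2Off ((fun x => x - v) ⁻¹' S) (fun x => f (x - v)) :=
  ⟨hf.stronglyMeasurable.comp_measurable (measurable_id.sub measurable_const),
    hf.memLp.comp_measurePreserving (measurePreserving_sub_right volume v),
    fun _ hx => hf.eq_zero _ hx⟩

variable [NormedSpace ℝ G]

protected lemma const_smul (c : ℝ) (hf : IsL2Off S f) : IsL2Off S (c • f) :=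
  ⟨hf.stronglyMeasurable.const_smul c, hf.memLp.const_smul c,
    fun x hx => by simp [hf.eq_zero x hx]⟩

protected lemma smul (hf : IsL2Off S f) (hη : Continuous η) (hηs : HasCompactSupport η) :
    IsL2Off (S ∩ tsupport η) (η • f) := by
  refine ⟨hη.stronglyMeasurable.smul hf.stronglyMeasurable,
    hf.memLp.smul (p := ⊤) (hη.memLp_of_hasCompactSupport hηs), fun x hx => ?_⟩
  rcases not_and_or.1 hx with h | h
  · simp [hf.eq_zero x h]
  · simp [image_eq_zero_of_notMem_tsupport h]

lemma integrable_smul (hf : IsL2Off S f) (hη : Continuous η) (hηs : HasCompactSupport η) :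
    Integrable (fun x => η x • f x) :=
  memLp_one_iff_integrable.1 (hf.memLp.smul (p := 2) (hη.memLp_of_hasCompactSupport hηs))

end IsL2Off

variable [DecidableEq ι] [NormedSpace ℝ G]

/-- `div F = h` on `ℝᵈ` in the sense of distributions. -/
def IsWeakDiv (F : ι → EuclideanSpace ℝ ι → G) (h : EuclideanSpace ℝ ι → G) : Prop :=
  ∀ φ : EuclideanSpace ℝ ι → ℝ, ContDiff ℝ ∞ φ → HasCompactSupport φ →
    ∑ j, ∫ x, pderiv j φ x • F j x = -∫ x, φ x • h x

lemma IsWeakDiv.sum_pderiv_mollify {F : ι → EuclideanSpace ℝ ι → G} {h : EuclideanSpace ℝ ι → G}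
    (H : IsWeakDiv F h) (hF : ∀ j, LocallyIntegrable (F j))
    (ζ : ContDiffBump (0 : EuclideanSpace ℝ ι)) :
    ∑ j, pderiv j (mollify ζ volume (F j)) = mollify ζ volume h := by
  ext x
  have hζ : ContDiff ℝ ∞ (ζ.normed volume) := ζ.contDiff_normed
  have hreflect (j : ι) (t : EuclideanSpace ℝ ι) :
      pderiv j (fun t => ζ.normed volume (x - t)) t = -pderiv j (ζ.normed volume) (x - t) := by
    have hd : HasFDerivAt (fun t => ζ.normed volume (x - t)) _ t :=
      (hζ.differentiable (by simp) (x - t)).hasFDerivAt.comp t ((hasFDerivAt_id t).const_sub x)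
    simp [pderiv, hd.fderiv]
  have htest := H (fun t => ζ.normed volume (x - t)) (hζ.comp (contDiff_const.sub contDiff_id))
    (ζ.hasCompactSupport_normed.comp_homeomorph (Homeomorph.subLeft x))
  simp only [hreflect, neg_smul, integral_neg, Finset.sum_neg_distrib, neg_inj] at htest
  simp only [Finset.sum_apply, pderiv, fderiv_mollify_apply ζ (hF _)]
  exact htest

/-- `div F = h` on `ℝᵈ` in the sense of distributions, where `F` and `h` are square integrable and
vanish off `S`. -/
structure HasWeakDiv (S : Set (EuclideanSpace ℝ ι)) (F : ι → EuclideanSpace ℝ ι → G)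
    (h : EuclideanSpace ℝ ι → G) : Prop where
  left : ∀ j, IsL2Off S (F j)
  right : IsL2Off S h
  div : IsWeakDiv F h

namespace HasWeakDiv

variable {F F' : ι → EuclideanSpace ℝ ι → G} {h h' : EuclideanSpace ℝ ι → G}

protected lemma zero : HasWeakDiv S (0 : ι → EuclideanSpace ℝ ι → G) 0 :=
  ⟨fun _ => .zero, .zero, fun φ _ _ => by simp⟩

protected lemma add (H : HasWeakDiv S F h) (H' : HasWeakDiv S F' h') :
    HasWeakDiv S (F + F') (h + h') := by
  refine ⟨fun j => (H.left j).add (H'.left j), H.right.add H'.right, fun φ hφ hs => ?_⟩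
  have hleft (j : ι) : ∫ x, pderiv j φ x • (F + F') j x =
      (∫ x, pderiv j φ x • F j x) + ∫ x, pderiv j φ x • F' j x := by
    have hc := (contDiff_pderiv hφ j).continuous
    have hcs := hasCompactSupport_pderiv hs j
    rw [← integral_add ((H.left j).integrable_smul hc hcs) ((H'.left j).integrable_smul hc hcs)]
    simp only [Pi.add_apply, smul_add]
  have hright : ∫ x, φ x • (h + h') x = (∫ x, φ x • h x) + ∫ x, φ x • h' x := by
    rw [← integral_add (H.right.integrable_smul hφ.continuous hs)
      (H'.right.integrable_smul hφ.continuous hs)]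
    simp only [Pi.add_apply, smul_add]
  simp only [hleft, hright, Finset.sum_add_distrib, neg_add, H.div φ hφ hs, H'.div φ hφ hs]

protected lemma const_smul (c : ℝ) (H : HasWeakDiv S F h) : HasWeakDiv S (c • F) (c • h) := by
  refine ⟨fun j => (H.left j).const_smul c, H.right.const_smul c, fun φ hφ hs => ?_⟩
  simp only [Pi.smul_apply, smul_comm _ c, integral_smul]
  rw [← Finset.smul_sum, H.div φ hφ hs, smul_neg]

protected lemma sum {κ : Type*} (s : Finset κ) {F : κ → ι → EuclideanSpace ℝ ι → G}
    {h : κ → EuclideanSpace ℝ ι → G} (H : ∀ k, HasWeakDiv S (F k) (h k)) :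
    HasWeakDiv S (∑ k ∈ s, F k) (∑ k ∈ s, h k) := by
  classical
  induction s using Finset.induction_on with
  | empty => exact .zero
  | insert a s ha ih => simpa only [Finset.sum_insert ha] using (H a).add ih

lemma mono (hST : S ⊆ T) (H : HasWeakDiv S F h) : HasWeakDiv T F h :=
  ⟨fun j => (H.left j).mono hST, H.right.mono hST, H.div⟩

protected lemma smul (H : HasWeakDiv S F h) (hη : ContDiff ℝ ∞ η) (hηs : HasCompactSupport η) :
    HasWeakDiv (S ∩ tsupport η) (fun j => η • F j) (η • h + ∑ j, pderiv j η • F j) := by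
  have hgrad (j : ι) : IsL2Off (S ∩ tsupport η) (pderiv j η • F j) :=
    ((H.left j).smul (contDiff_pderiv hη j).continuous (hasCompactSupport_pderiv hηs j)).mono
      (Set.inter_subset_inter_right _ (tsupport_pderiv_subset η j))
  have hleft (j : ι) : IsL2Off (S ∩ tsupport η) (η • F j) := (H.left j).smul hη.continuous hηs
  refine ⟨hleft, (H.right.smul hη.continuous hηs).add (.sum _ hgrad), fun φ hφ hs => ?_⟩
  have htest := H.div (η * φ) (hη.mul hφ) hs.mul_left
  have hleibniz (j : ι) : ∫ x, pderiv j (η * φ) x • F j x =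
      (∫ x, φ x • (pderiv j η • F j) x) + ∫ x, pderiv j φ x • (η • F j) x := by
    rw [← integral_add ((hgrad j).integrable_smul hφ.continuous hs) ((hleft j).integrable_smul
      (contDiff_pderiv hφ j).continuous (hasCompactSupport_pderiv hs j))]
    refine integral_congr_ae (.of_forall fun x => ?_)
    simp only [pderiv_mul hη hφ, Pi.smul_apply', smul_smul, add_smul, mul_comm]
  have hright : ∫ x, φ x • (η • h + ∑ j, pderiv j η • F j) x =
      (∫ x, (η * φ) x • h x) + ∑ j, ∫ x, φ x • (pderiv j η • F j) x := by
    have h_int (j : ι) : Integrable fun x => φ x • (pderiv j η • F j) x :=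
      (hgrad j).integrable_smul hφ.continuous hs
    have hmul : Integrable fun x => (η * φ) x • h x :=
      H.right.integrable_smul (hη.mul hφ).continuous hs.mul_left
    rw [← integral_finsetSum _ fun j _ => h_int j, ← integral_add hmul
      (integrable_finsetSum _ fun j _ => h_int j)]
    refine integral_congr_ae (.of_forall fun x => ?_)
    simp only [Pi.add_apply, Pi.smul_apply', Finset.sum_apply, smul_add, smul_smul, Pi.mul_apply,
      Finset.smul_sum, mul_comm]
  simp only [hleibniz, Finset.sum_add_distrib] at htest
  rw [hright, neg_add, ← htest]
  abel

lemma translate (H : HasWeakDiv S F h) (v : EuclideanSpace ℝ ι) :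
    HasWeakDiv ((fun x => x - v) ⁻¹' S) (fun j x => F j (x - v)) (fun x => h (x - v)) := by
  refine ⟨fun j => (H.left j).translate v, H.right.translate v, fun φ hφ hs => ?_⟩
  have htest := H.div (fun y => φ (y + v)) (hφ.comp (contDiff_id.add contDiff_const))
    (hs.comp_homeomorph (Homeomorph.addRight v))
  have hshift (j : ι) (y : EuclideanSpace ℝ ι) :
      pderiv j (fun y => φ (y + v)) y = pderiv j φ (y + v) := by
    simp only [pderiv, fderiv_comp_add_right]
  simp only [hshift] at htest
  rw [← integral_sub_right_eq_self (fun x => φ (x + v) • h x) v] at htest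
  simp only [← integral_sub_right_eq_self (fun x => pderiv _ φ (x + v) • F _ x) v,
    sub_add_cancel] at htest
  exact htest

lemma ae_eq_zero [CompleteSpace G] (H : HasWeakDiv S F h) (hF : ∀ j, F j =ᵐ[volume] 0) :
    h =ᵐ[volume] 0 := by
  refine ae_eq_zero_of_integral_contDiff_smul_eq_zero H.right.locallyIntegrable fun φ hφ hs => ?_
  rw [← neg_eq_zero, ← H.div φ hφ hs]
  refine Finset.sum_eq_zero fun j _ => integral_eq_zero_of_ae ?_
  filter_upwards [hF j] with x hx
  simp [hx]

end HasWeakDiv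

end WeakDivergence

section Stress

variable {ι N N' : Type*} [Fintype ι] [DecidableEq ι] [AddCommGroup N] [Module ℝ N]
  [AddCommGroup N'] [Module ℝ N'] (lam mu : ℝ)

/-- The stress tensor `λ (tr D) I + μ (D + Dᵀ)` of a displacement gradient `D i j = ∂_j w_i`; the
entries may be vectors, functions or test functions. -/
def stressOf (D : ι → ι → N) (i j : ι) : N :=
  (if i = j then lam • ∑ k, D k k else 0) + mu • (D i j + D j i)

lemma stressOf_zero (i j : ι) : stressOf lam mu (0 : ι → ι → N) i j = 0 := by
  simp [stressOf]

lemma stressOf_add (D D' : ι → ι → N) :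
    stressOf lam mu (D + D') = stressOf lam mu D + stressOf lam mu D' := by
  ext i j
  simp only [stressOf, Pi.add_apply, Finset.sum_add_distrib]
  split_ifs <;> module

lemma stressOf_const_smul (c : ℝ) (D : ι → ι → N) :
    stressOf lam mu (c • D) = c • stressOf lam mu D := by
  ext i j
  simp only [stressOf, Pi.smul_apply, ← Finset.smul_sum]
  split_ifs <;> module

lemma map_stressOf (T : N →ₗ[ℝ] N') (D : ι → ι → N) (i j : ι) :
    T (stressOf lam mu D i j) = stressOf lam mu (fun i j => T (D i j)) i j := by
  simp only [stressOf, map_add, map_smul, apply_ite T, map_sum, map_zero]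

lemma stressOf_apply {X : Type*} (D : ι → ι → X → N) (i j : ι) (x : X) :
    stressOf lam mu D i j x = stressOf lam mu (fun i j => D i j x) i j :=
  map_stressOf lam mu (LinearMap.proj x) D i j

end Stress

section WeakLame

open ContDiff

variable {ι G : Type*} [Fintype ι] [DecidableEq ι] [NormedAddCommGroup G] [NormedSpace ℝ G]
  {lam mu : ℝ} {S T : Set (EuclideanSpace ℝ ι)} {η : EuclideanSpace ℝ ι → ℝ}

protected lemma IsL2Off.stressOf {D : ι → ι → EuclideanSpace ℝ ι → G}
    (hD : ∀ i j, IsL2Off S (D i j)) (i j : ι) : IsL2Off S (stressOf lam mu D i j) := by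
  refine .add ?_ (((hD i j).add (hD j i)).const_smul mu)
  split_ifs
  · exact (IsL2Off.sum Finset.univ fun k => hD k k).const_smul lam
  · exact .zero

/-- `∂_j f = d` on `ℝᵈ` in the sense of distributions, where `f` and `d` are square integrable and
vanish off `S`. -/
def HasWeakPartial (S : Set (EuclideanSpace ℝ ι)) (j : ι) (f d : EuclideanSpace ℝ ι → G) : Prop :=
  HasWeakDiv S (Pi.single j f) d

namespace HasWeakPartial

variable {j : ι} {f f' d d' : EuclideanSpace ℝ ι → G}

lemma isL2Off_left (H : HasWeakPartial S j f d) : IsL2Off S f := by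
  simpa using H.left j

protected lemma zero : HasWeakPartial S j (0 : EuclideanSpace ℝ ι → G) 0 := by
  simpa only [HasWeakPartial, Pi.single_zero] using HasWeakDiv.zero

protected lemma add (H : HasWeakPartial S j f d) (H' : HasWeakPartial S j f' d') :
    HasWeakPartial S j (f + f') (d + d') := by
  simpa only [HasWeakPartial, Pi.single_add] using HasWeakDiv.add H H'

protected lemma const_smul (c : ℝ) (H : HasWeakPartial S j f d) :
    HasWeakPartial S j (c • f) (c • d) := by
  simpa only [HasWeakPartial, Pi.single_smul] using HasWeakDiv.const_smul c H

protected lemma sum {κ : Type*} (s : Finset κ) {f d : κ → EuclideanSpace ℝ ι → G}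
    (H : ∀ k, HasWeakPartial S j (f k) (d k)) :
    HasWeakPartial S j (∑ k ∈ s, f k) (∑ k ∈ s, d k) := by
  simpa only [HasWeakPartial, ← AddMonoidHom.single_apply, map_sum] using HasWeakDiv.sum s H

protected lemma smul (H : HasWeakPartial S j f d) (hη : ContDiff ℝ ∞ η)
    (hηs : HasCompactSupport η) :
    HasWeakPartial (S ∩ tsupport η) j (η • f) (η • d + pderiv j η • f) := by
  have hsingle : (fun k => η • (Pi.single j f : ι → EuclideanSpace ℝ ι → G) k) =
      Pi.single j (η • f) :=
    funext fun k => by rcases eq_or_ne k j with rfl | hk <;> simp [*]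
  have hsum : ∑ k, pderiv k η • (Pi.single j f : ι → EuclideanSpace ℝ ι → G) k =
      pderiv j η • f := by
    rw [Finset.sum_eq_single j (fun k _ hk => by simp [hk]) (by simp), Pi.single_eq_same]
  simpa only [HasWeakPartial, hsingle, hsum] using HasWeakDiv.smul H hη hηs

lemma translate (H : HasWeakPartial S j f d) (v : EuclideanSpace ℝ ι) :
    HasWeakPartial ((fun x => x - v) ⁻¹' S) j (fun x => f (x - v)) (fun x => d (x - v)) := by
  have hsingle : (fun k x => (Pi.single j f : ι → EuclideanSpace ℝ ι → G) k (x - v)) =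
      Pi.single j fun x => f (x - v) :=
    funext fun k => by rcases eq_or_ne k j with rfl | hk <;> [simp; (simp [hk]; rfl)]
  simpa only [HasWeakPartial, hsingle] using HasWeakDiv.translate H v

lemma ae_eq_zero [CompleteSpace G] (H : HasWeakPartial S j 0 d) : d =ᵐ[volume] 0 :=
  HasWeakDiv.ae_eq_zero H fun k => by simp

lemma pderiv_mollify (H : HasWeakPartial S j f d) (ζ : ContDiffBump (0 : EuclideanSpace ℝ ι)) :
    pderiv j (mollify ζ volume f) = mollify ζ volume d := by
  rw [← H.div.sum_pderiv_mollify (fun k => (H.left k).locallyIntegrable) ζ,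
    Finset.sum_eq_single j _ (by simp), Pi.single_eq_same]
  intro k _ hk
  ext x
  simp [hk, mollify_zero, pderiv]

protected lemma stressOf {l : ι} {D D' : ι → ι → EuclideanSpace ℝ ι → G}
    (H : ∀ i j, HasWeakPartial S l (D i j) (D' i j)) (i j : ι) :
    HasWeakPartial S l (stressOf lam mu D i j) (stressOf lam mu D' i j) := by
  refine .add ?_ (((H i j).add (H j i)).const_smul mu)
  split_ifs
  · exact (HasWeakPartial.sum Finset.univ fun k => H k k).const_smul lam
  · exact .zero

end HasWeakPartial

lemma hasWeakDiv_of_hasWeakPartial {F d : ι → EuclideanSpace ℝ ι → G}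
    (H : ∀ j, HasWeakPartial S j (F j) (d j)) : HasWeakDiv S F (∑ j, d j) := by
  simpa only [Finset.univ_sum_single] using HasWeakDiv.sum Finset.univ H

/-- `Δ* w = L` on `ℝᵈ` in the sense of distributions, where `w`, its gradient and `L` are square
integrable and vanish off `S`; `Δ*` is the divergence of the stress tensor. -/
def HasWeakLame (lam mu : ℝ) (S : Set (EuclideanSpace ℝ ι))
    (w L : ι → EuclideanSpace ℝ ι → G) : Prop :=
  ∃ D : ι → ι → EuclideanSpace ℝ ι → G, (∀ i j, HasWeakPartial S j (w i) (D i j)) ∧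
    ∀ i, HasWeakDiv S (stressOf lam mu D i) (L i)

namespace HasWeakLame

variable {w w' L L' : ι → EuclideanSpace ℝ ι → G}

lemma isL2Off_left (H : HasWeakLame lam mu S w L) (i : ι) : IsL2Off S (w i) :=
  let ⟨_, hD, _⟩ := H
  (hD i i).isL2Off_left

lemma isL2Off_right (H : HasWeakLame lam mu S w L) (i : ι) : IsL2Off S (L i) :=
  let ⟨_, _, hL⟩ := H
  (hL i).right

lemma mono (hST : S ⊆ T) (H : HasWeakLame lam mu S w L) : HasWeakLame lam mu T w L :=
  let ⟨D, hD, hL⟩ := H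
  ⟨D, fun i j => (hD i j).mono hST, fun i => (hL i).mono hST⟩

protected lemma add (H : HasWeakLame lam mu S w L) (H' : HasWeakLame lam mu S w' L') :
    HasWeakLame lam mu S (w + w') (L + L') := by
  obtain ⟨D, hD, hL⟩ := H
  obtain ⟨D', hD', hL'⟩ := H'
  refine ⟨D + D', fun i j => (hD i j).add (hD' i j), fun i => ?_⟩
  rw [stressOf_add]
  exact (hL i).add (hL' i)

protected lemma const_smul (c : ℝ) (H : HasWeakLame lam mu S w L) :
    HasWeakLame lam mu S (c • w) (c • L) := by
  obtain ⟨D, hD, hL⟩ := H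
  refine ⟨c • D, fun i j => (hD i j).const_smul c, fun i => ?_⟩
  rw [stressOf_const_smul]
  exact (hL i).const_smul c

protected lemma sub (H : HasWeakLame lam mu S w L) (H' : HasWeakLame lam mu S w' L') :
    HasWeakLame lam mu S (w - w') (L - L') := by
  simpa only [neg_one_smul, ← sub_eq_add_neg] using H.add (H'.const_smul (-1))

-- The Leibniz correction `∂_j η • w_i` to the gradient is itself weakly differentiable, so the
-- corrected stress tensor again has a square integrable divergence.
lemma exists_smul (H : HasWeakLame lam mu S w L) (hη : ContDiff ℝ ∞ η)
    (hηs : HasCompactSupport η) :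
    ∃ L', HasWeakLame lam mu (S ∩ tsupport η) (fun i => η • w i) L' := by
  obtain ⟨D, hD, hL⟩ := H
  let E : ι → ι → EuclideanSpace ℝ ι → G := fun i j => pderiv j η • w i
  have hE (l i j : ι) : HasWeakPartial (S ∩ tsupport η) l (E i j)
      (pderiv j η • D i l + pderiv l (pderiv j η) • w i) :=
    ((hD i l).smul (contDiff_pderiv hη j) (hasCompactSupport_pderiv hηs j)).mono
      (Set.inter_subset_inter_right _ (tsupport_pderiv_subset η j))
  have hstress (i : ι) : stressOf lam mu (fun i j => η • D i j + E i j) i =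
      (fun j => η • stressOf lam mu D i j) + stressOf lam mu E i := by
    have hη : stressOf lam mu (fun i j => η • D i j) i = fun j => η • stressOf lam mu D i j := by
      ext j x
      simp only [stressOf_apply, Pi.smul_apply']
      exact (map_stressOf lam mu (η x • LinearMap.id : G →ₗ[ℝ] G) (fun i j => D i j x) i j).symm
    rw [← hη]
    exact congrFun (stressOf_add lam mu _ E) i
  have hlame (i : ι) := ((hL i).smul hη hηs).add <| hasWeakDiv_of_hasWeakPartial fun j =>
    HasWeakPartial.stressOf (lam := lam) (mu := mu) (hE j) i j
  simp only [← hstress] at hlame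
  exact ⟨_, _, fun i j => (hD i j).smul hη hηs, hlame⟩

lemma translate (H : HasWeakLame lam mu S w L) (v : EuclideanSpace ℝ ι) :
    HasWeakLame lam mu ((fun x => x - v) ⁻¹' S) (fun i x => w i (x - v))
      (fun i x => L i (x - v)) := by
  obtain ⟨D, hD, hL⟩ := H
  refine ⟨fun i j x => D i j (x - v), fun i j => (hD i j).translate v, fun i => ?_⟩
  have hstress : stressOf lam mu (fun i j x => D i j (x - v)) i =
      fun j x => stressOf lam mu D i j (x - v) :=
    funext fun j => (map_stressOf lam mu (LinearMap.funLeft ℝ G fun x => x - v) D i j).symm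
  rw [hstress]
  exact (hL i).translate v

lemma ae_eq_zero [CompleteSpace G] (H : HasWeakLame lam mu S 0 L) (i : ι) :
    L i =ᵐ[volume] 0 := by
  obtain ⟨D, hD, hL⟩ := H
  have hD0 : ∀ᵐ x : EuclideanSpace ℝ ι, ∀ i j, D i j x = 0 :=
    ae_all_iff.2 fun i => ae_all_iff.2 fun j => (hD i j).ae_eq_zero
  refine (hL i).ae_eq_zero fun j => ?_
  filter_upwards [hD0] with x hx
  simp only [stressOf_apply, hx]
  exact stressOf_zero lam mu i j

end HasWeakLame

end WeakLame

section SegmentProperty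

open Filter Topology

variable {E : Type*} [NormedAddCommGroup E] [NormedSpace ℝ E]

/-- The segment property: near each boundary point of `s`, a small translation in a suitable
direction `v` moves the closure of `s` into `s`. -/
def HasSegmentProperty (s : Set E) : Prop :=
  ∀ x ∈ frontier s, ∃ U ∈ 𝓝 x, ∃ v : E, ∀ᶠ t : ℝ in 𝓝[>] 0, ∀ y ∈ closure s ∩ U, y + t • v ∈ s

lemma HasSegmentProperty.exists_translation {s : Set E} (hs : HasSegmentProperty s) {x : E}
    (hx : x ∈ closure s) :
    ∃ U ∈ 𝓝 x, ∃ v : E, ∀ᶠ t : ℝ in 𝓝[>] 0, ∀ y ∈ closure s ∩ U, y + t • v ∈ s := by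
  by_cases hxs : x ∈ interior s
  · exact ⟨s, mem_interior_iff_mem_nhds.1 hxs, 0, .of_forall fun t y hy => by simpa using hy.2⟩
  · exact hs x ⟨hx, hxs⟩

lemma tendsto_fst_add_snd_smul (x v : E) :
    Tendsto (fun p : E × ℝ => p.1 + p.2 • v) (𝓝 x ×ˢ 𝓝[>] 0) (𝓝 x) := by
  have h : ContinuousAt (fun p : E × ℝ => p.1 + p.2 • v) (x, 0) := by fun_prop
  have h' : Tendsto (fun p : E × ℝ => p.1 + p.2 • v) (𝓝 (x, 0)) (𝓝 x) := by
    simpa [ContinuousAt] using h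
  rw [nhds_prod_eq] at h'
  exact h'.mono_left (prod_mono_right _ nhdsWithin_le_nhds)

lemma eventually_lt_of_hasStrictFDerivAt {ψ : E → ℝ} {ψ' : E →L[ℝ] ℝ} {x v : E}
    (hψ : HasStrictFDerivAt ψ ψ' x) (hv : ψ' v < 0) :
    ∀ᶠ p : E × ℝ in 𝓝 x ×ˢ 𝓝[>] 0, ψ (p.1 + p.2 • v) < ψ p.1 := by
  have hv0 : 0 < ‖v‖ := norm_pos_iff.2 (by rintro rfl; simp at hv)
  have hlim : Tendsto (fun p : E × ℝ => (p.1 + p.2 • v, p.1)) (𝓝 x ×ˢ 𝓝[>] 0) (𝓝 (x, x)) :=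
    (tendsto_fst_add_snd_smul x v).prodMk_nhds tendsto_fst
  have hest := hlim.eventually (hψ.isLittleO.def (c := -ψ' v / (2 * ‖v‖))
    (div_pos (neg_pos.2 hv) (by positivity)))
  filter_upwards [hest, tendsto_snd.eventually self_mem_nhdsWithin] with p hp hp0
  have hp0 : 0 < p.2 := hp0
  have hc : -ψ' v / (2 * ‖v‖) * ‖p.2 • v‖ = -(p.2 * ψ' v) / 2 := by
    rw [norm_smul, Real.norm_of_nonneg hp0.le]
    field_simp
  simp only [add_sub_cancel_left, map_smul, smul_eq_mul, hc] at hp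
  linarith [(abs_le.1 hp).2, mul_neg_of_pos_of_neg hp0 hv]

lemma HasC2Boundary.hasSegmentProperty {Ω : Opens E3} (hΩ : HasC2Boundary Ω) :
    HasSegmentProperty (Ω : Set E3) := by
  intro x hx
  obtain ⟨W, hW, hxW, ψ, hψ, hψ', -, hΩψ⟩ := hΩ x hx
  obtain ⟨v, hv⟩ : ∃ v, fderiv ℝ ψ x v < 0 := by
    obtain ⟨v, hv⟩ := DFunLike.ne_iff.1 (hψ' x hxW)
    rcases lt_or_gt_of_ne hv with h | h
    · exact ⟨v, h⟩
    · exact ⟨-v, by simpa using h⟩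
  have hclosure : ∀ y ∈ closure (Ω : Set E3) ∩ W, ψ y ≤ 0 := by
    rintro y ⟨hyΩ, hyW⟩
    by_contra! hy
    have hcont : ContinuousAt ψ y := (hψ.contDiffAt (hW.mem_nhds hyW)).continuousAt
    obtain ⟨z, ⟨hz, hzW⟩, hzΩ⟩ := mem_closure_iff_nhds.1 hyΩ _
      (inter_mem (hcont.eventually_const_lt hy) (hW.mem_nhds hyW))
    exact hz.not_gt ((hΩψ z hzW).1 hzΩ)
  have hstrict := (hψ.contDiffAt (hW.mem_nhds hxW)).hasStrictFDerivAt (by simp)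
  obtain ⟨U, hU, P, hP, h⟩ := eventually_prod_iff.1
    ((eventually_lt_of_hasStrictFDerivAt hstrict hv).and
      ((tendsto_fst_add_snd_smul x v).eventually (hW.mem_nhds hxW)))
  refine ⟨{y | U y} ∩ W, inter_mem hU (hW.mem_nhds hxW), v, ?_⟩
  filter_upwards [hP] with t ht y ⟨hyΩ, hyU, hyW⟩
  obtain ⟨hlt, htW⟩ := h hyU ht
  exact (hΩψ _ htW).2 (hlt.trans_le (hclosure y ⟨hyΩ, hyW⟩))

end SegmentProperty

section TestApproximation

open Filter Topology ContDiff

variable {Ω : Opens E3} {lam mu : ℝ} {K : Set E3} {w w' L L' : Fin 3 → E3 → ℂ} {η θ : E3 → ℝ}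

lemma lameTest_eq_sum_lineDeriv (Φ : Fin 3 → 𝓓(Ω, ℂ)) (i : Fin 3) :
    lameTest lam mu Φ i = ∑ j, ∂_{e j} (stressOf lam mu (fun i j => ∂_{e j} (Φ i)) i j) := by
  have hdiag (φ : 𝓓(Ω, ℂ)) (j : Fin 3) :
      (∂_{e j} (if i = j then φ else 0) : 𝓓(Ω, ℂ)) = if i = j then ∂_{e i} φ else 0 := by
    split_ifs with h
    · rw [h]
    · exact LineDeriv.lineDerivOp_zero _
  simp only [lameTest, stressOf, LineDeriv.lineDerivOp_add, LineDeriv.lineDerivOp_smul,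
    LineDeriv.lineDerivOp_sum, hdiag, Finset.sum_add_distrib, Finset.sum_ite_eq,
    Finset.mem_univ, if_true, ← Finset.smul_sum, lineDeriv_comm_test _ _ (e i)]
  module

lemma lameTest_add (Φ Ψ : Fin 3 → 𝓓(Ω, ℂ)) (i : Fin 3) :
    lameTest lam mu (Φ + Ψ) i = lameTest lam mu Φ i + lameTest lam mu Ψ i := by
  simp only [lameTest, Pi.add_apply, LineDeriv.lineDerivOp_add, Finset.sum_add_distrib]
  module

lemma lameTest_zero (i : Fin 3) : lameTest lam mu (0 : Fin 3 → 𝓓(Ω, ℂ)) i = 0 := by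
  simp [lameTest, LineDeriv.lineDerivOp_zero]

lemma coe_lineDeriv_test (φ : 𝓓(Ω, ℂ)) (j : Fin 3) :
    ((∂_{e j} φ : 𝓓(Ω, ℂ)) : E3 → ℂ) = pderiv j φ :=
  funext fun x => lineDeriv_test_apply φ (e j) x

lemma coe_stressOf_test (D : Fin 3 → Fin 3 → 𝓓(Ω, ℂ)) (i j : Fin 3) :
    ⇑(stressOf lam mu D i j) = stressOf lam mu (fun i j => (D i j : E3 → ℂ)) i j := by
  unfold stressOf
  split_ifs <;> simp [FunLike.coe_sum]

lemma memLp_test (φ : 𝓓(Ω, ℂ)) : MemLp φ 2 volume :=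
  φ.continuous.memLp_of_hasCompactSupport φ.hasCompactSupport

lemma mollify_stressOf (ζ : ContDiffBump (0 : E3)) {D : Fin 3 → Fin 3 → E3 → ℂ}
    (hD : ∀ i j, LocallyIntegrable (D i j)) (i j : Fin 3) :
    mollify ζ volume (stressOf lam mu D i j) =
      stressOf lam mu (fun i j => mollify ζ volume (D i j)) i j := by
  have hdiv : LocallyIntegrable (∑ k, D k k) volume :=
    locallyIntegrable_finsetSum' _ fun k _ => hD k k
  have hsymm := ((hD i j).add (hD j i)).smul mu
  unfold stressOf
  split_ifs
  · rw [mollify_add ζ (hdiv.smul lam) hsymm, mollify_const_smul, mollify_const_smul,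
      mollify_sum ζ _ fun k => hD k k, mollify_add ζ (hD i j) (hD j i)]
  · rw [zero_add, zero_add, mollify_const_smul, mollify_add ζ (hD i j) (hD j i)]

lemma lameTest_eq_mollify {ζ : ContDiffBump (0 : E3)} (H : HasWeakLame lam mu K w L)
    {Φ : Fin 3 → 𝓓(Ω, ℂ)} (hΦ : ∀ i, (Φ i : E3 → ℂ) = mollify ζ volume (w i)) (i : Fin 3) :
    (lameTest lam mu Φ i : E3 → ℂ) = mollify ζ volume (L i) := by
  obtain ⟨D, hD, hL⟩ := H
  have hgrad (i j : Fin 3) : ((∂_{e j} (Φ i) : 𝓓(Ω, ℂ)) : E3 → ℂ) = mollify ζ volume (D i j) := by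
    rw [coe_lineDeriv_test, hΦ, (hD i j).pderiv_mollify]
  rw [lameTest_eq_sum_lineDeriv, FunLike.coe_sum,
    ← (hL i).div.sum_pderiv_mollify (fun j => ((hL i).left j).locallyIntegrable) ζ]
  simp only [coe_lineDeriv_test, coe_stressOf_test,
    mollify_stressOf ζ fun i j => (hD i j).right.locallyIntegrable]
  simp only [← coe_lineDeriv_test, hgrad]

lemma exists_test_eq_mollify {f : E3 → ℂ} {ζ : ContDiffBump (0 : E3)} (hK : IsCompact K)
    (hKΩ : Metric.cthickening ζ.rOut K ⊆ Ω) (hf : IsL2Off K f) :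
    ∃ φ : 𝓓(Ω, ℂ), (φ : E3 → ℂ) = mollify ζ volume f :=
  have hsupp := tsupport_mollify_subset (μ := volume) ζ hf.eq_zero
  ⟨⟨_, contDiff_mollify ζ hf.locallyIntegrable,
    hK.cthickening.of_isClosed_subset (isClosed_tsupport _) hsupp, hsupp.trans hKΩ⟩, rfl⟩

/-- `(w, L)` is a limit in `L²` of pairs `(Φ, Δ* Φ)` with test fields `Φ`. -/
def IsTestLimit (Ω : Opens E3) (lam mu : ℝ) (w L : Fin 3 → E3 → ℂ) : Prop :=
  ∀ ε : ℝ≥0∞, 0 < ε → ∃ Φ : Fin 3 → 𝓓(Ω, ℂ), ∀ i,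
    eLpNorm (⇑(Φ i) - w i) 2 volume ≤ ε ∧ eLpNorm (⇑(lameTest lam mu Φ i) - L i) 2 volume ≤ ε

lemma eLpNorm_add_le_of_le_half {f g : E3 → ℂ} {ε : ℝ≥0∞} (hf : AEStronglyMeasurable f)
    (hg : AEStronglyMeasurable g) (hfε : eLpNorm f 2 volume ≤ ε / 2)
    (hgε : eLpNorm g 2 volume ≤ ε / 2) : eLpNorm (f + g) 2 volume ≤ ε := by
  rw [← ENNReal.add_halves ε]
  exact (eLpNorm_add_le hf hg one_le_two).trans (add_le_add hfε hgε)

namespace IsTestLimit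

protected lemma zero : IsTestLimit Ω lam mu 0 0 := fun ε _ =>
  ⟨0, fun i => by simp [lameTest_zero]⟩

protected lemma add (H : IsTestLimit Ω lam mu w L) (H' : IsTestLimit Ω lam mu w' L')
    (hw : ∀ i, AEStronglyMeasurable (w i)) (hw' : ∀ i, AEStronglyMeasurable (w' i))
    (hL : ∀ i, AEStronglyMeasurable (L i)) (hL' : ∀ i, AEStronglyMeasurable (L' i)) :
    IsTestLimit Ω lam mu (w + w') (L + L') := by
  intro ε hε
  obtain ⟨Φ, hΦ⟩ := H (ε / 2) (ENNReal.half_pos hε.ne')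
  obtain ⟨Ψ, hΨ⟩ := H' (ε / 2) (ENNReal.half_pos hε.ne')
  refine ⟨Φ + Ψ, fun i => ⟨?_, ?_⟩⟩
  · rw [Pi.add_apply, Pi.add_apply, FunLike.coe_add, add_sub_add_comm]
    exact eLpNorm_add_le_of_le_half ((memLp_test _).1.sub (hw i)) ((memLp_test _).1.sub (hw' i))
      (hΦ i).1 (hΨ i).1
  · rw [lameTest_add, Pi.add_apply, FunLike.coe_add, add_sub_add_comm]
    exact eLpNorm_add_le_of_le_half ((memLp_test _).1.sub (hL i)) ((memLp_test _).1.sub (hL' i))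
      (hΦ i).2 (hΨ i).2

lemma congr_right (H : IsTestLimit Ω lam mu w L) (hL : ∀ i, L i =ᵐ[volume] L' i) :
    IsTestLimit Ω lam mu w L' := by
  intro ε hε
  obtain ⟨Φ, hΦ⟩ := H ε hε
  exact ⟨Φ, fun i => ⟨(hΦ i).1, (eLpNorm_congr_ae (EventuallyEq.rfl.sub (hL i).symm)).trans_le
    (hΦ i).2⟩⟩

lemma of_tendsto {α : Type*} {l : Filter α} [l.NeBot] {f g : α → Fin 3 → E3 → ℂ}
    (hf : ∀ a i, AEStronglyMeasurable (f a i)) (hg : ∀ a i, AEStronglyMeasurable (g a i))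
    (hw : ∀ i, AEStronglyMeasurable (w i)) (hL : ∀ i, AEStronglyMeasurable (L i))
    (hfw : ∀ i, Tendsto (fun a => eLpNorm (f a i - w i) 2 volume) l (𝓝 0))
    (hgL : ∀ i, Tendsto (fun a => eLpNorm (g a i - L i) 2 volume) l (𝓝 0))
    (H : ∀ᶠ a in l, IsTestLimit Ω lam mu (f a) (g a)) : IsTestLimit Ω lam mu w L := by
  intro ε hε
  have hε2 : 0 < ε / 2 := ENNReal.half_pos hε.ne'
  obtain ⟨a, ha, hfa, hga⟩ := (H.and
    ((eventually_all.2 fun i => (hfw i).eventually_le_const hε2).and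
      (eventually_all.2 fun i => (hgL i).eventually_le_const hε2))).exists
  obtain ⟨Φ, hΦ⟩ := ha (ε / 2) hε2
  refine ⟨Φ, fun i => ⟨?_, ?_⟩⟩
  · rw [← sub_add_sub_cancel _ (f a i)]
    exact eLpNorm_add_le_of_le_half ((memLp_test _).1.sub (hf a i)) ((hf a i).sub (hw i))
      (hΦ i).1 (hfa i)
  · rw [← sub_add_sub_cancel _ (g a i)]
    exact eLpNorm_add_le_of_le_half ((memLp_test _).1.sub (hg a i)) ((hg a i).sub (hL i))
      (hΦ i).2 (hga i)

end IsTestLimit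

namespace HasWeakLame

lemma isTestLimit_of_isCompact (hK : IsCompact K) (hKΩ : K ⊆ Ω) (H : HasWeakLame lam mu K w L) :
    IsTestLimit Ω lam mu w L := by
  intro ε hε
  obtain ⟨δ, hδ, hδΩ⟩ := hK.exists_cthickening_subset_open Ω.isOpen hKΩ
  have hclose {f : Fin 3 → E3 → ℂ} (hf : ∀ i, IsL2Off K (f i)) :
      ∀ᶠ y : E3 in 𝓝 0, ∀ i, eLpNorm (fun x => f i (x - y) - f i x) 2 volume ≤ ε :=
    eventually_all.2 fun i => (tendsto_eLpNorm_comp_sub_right_sub (by simp)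
      (hf i).memLp).eventually_le_const hε
  obtain ⟨r, hr, hball⟩ := Metric.eventually_nhds_iff_ball.1
    ((hclose H.isL2Off_left).and (hclose H.isL2Off_right))
  let ζ : ContDiffBump (0 : E3) :=
    ⟨min δ r / 2, min δ r, half_pos (lt_min hδ hr), half_lt_self (lt_min hδ hr)⟩
  have hζ : Metric.cthickening ζ.rOut K ⊆ Ω :=
    (Metric.cthickening_mono (min_le_left _ _) _).trans hδΩ
  have hζr (y : E3) (hy : ‖y‖ < ζ.rOut) : y ∈ Metric.ball (0 : E3) r :=
    mem_ball_zero_iff.2 (hy.trans_le (min_le_right _ _))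
  choose Φ hΦ using fun i => exists_test_eq_mollify hK hζ (H.isL2Off_left i)
  refine ⟨Φ, fun i => ⟨?_, ?_⟩⟩
  · rw [hΦ]
    exact eLpNorm_mollify_sub_le one_le_two (by simp) ζ (H.isL2Off_left i).stronglyMeasurable
      (H.isL2Off_left i).memLp fun y hy => (hball y (hζr y hy)).1 i
  · rw [lameTest_eq_mollify H hΦ]
    exact eLpNorm_mollify_sub_le one_le_two (by simp) ζ (H.isL2Off_right i).stronglyMeasurable
      (H.isL2Off_right i).memLp fun y hy => (hball y (hζr y hy)).2 i

lemma isTestLimit_of_eventually_translate (hK : IsCompact K) {v : E3}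
    (hv : ∀ᶠ t : ℝ in 𝓝[>] 0, ∀ y ∈ K, y + t • v ∈ Ω) (H : HasWeakLame lam mu K w L) :
    IsTestLimit Ω lam mu w L := by
  have hlim : Tendsto (fun t : ℝ => t • v) (𝓝[>] 0) (𝓝 0) :=
    (Continuous.tendsto' (by fun_prop) 0 0 (zero_smul ℝ v)).mono_left nhdsWithin_le_nhds
  have htranslate {f : Fin 3 → E3 → ℂ} (hf : ∀ i, IsL2Off K (f i)) (i : Fin 3) :
      Tendsto (fun t : ℝ => eLpNorm ((fun x => f i (x - t • v)) - f i) 2 volume) (𝓝[>] 0) (𝓝 0) :=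
    (tendsto_eLpNorm_comp_sub_right_sub (by simp) (hf i).memLp).comp hlim
  refine .of_tendsto
    (fun t i => ((H.translate (t • v)).isL2Off_left i).stronglyMeasurable.aestronglyMeasurable)
    (fun t i => ((H.translate (t • v)).isL2Off_right i).stronglyMeasurable.aestronglyMeasurable)
    (fun i => (H.isL2Off_left i).stronglyMeasurable.aestronglyMeasurable)
    (fun i => (H.isL2Off_right i).stronglyMeasurable.aestronglyMeasurable)
    (htranslate H.isL2Off_left) (htranslate H.isL2Off_right) ?_
  filter_upwards [hv] with t ht
  exact (H.translate (t • v)).isTestLimit_of_isCompact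
    ((Homeomorph.subRight (t • v)).isCompact_preimage.2 hK) fun z hz => by simpa using ht _ hz

end HasWeakLame

/-- Multiplication by `η` changes a field with a weak `Δ*` only by a limit of test fields. Products
of such functions are again such, which globalises the local approximation. -/
def IsHarmlessCutoff (Ω : Opens E3) (lam mu : ℝ) (η : E3 → ℝ) : Prop :=
  ∀ w L, HasWeakLame lam mu Ω w L → ∃ L', HasWeakLame lam mu Ω (fun i => η • w i) L' ∧
    IsTestLimit Ω lam mu (w - fun i => η • w i) (L - L')

namespace IsHarmlessCutoff

protected lemma one : IsHarmlessCutoff Ω lam mu 1 := fun w L H =>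
  ⟨L, by simpa using H, by simpa using IsTestLimit.zero⟩

protected lemma mul (hη : IsHarmlessCutoff Ω lam mu η) (hθ : IsHarmlessCutoff Ω lam mu θ) :
    IsHarmlessCutoff Ω lam mu (η * θ) := by
  intro w L H
  obtain ⟨L₁, H₁, hlim₁⟩ := hθ w L H
  obtain ⟨L₂, H₂, hlim₂⟩ := hη _ L₁ H₁
  refine ⟨L₂, by simpa only [mul_smul] using H₂, ?_⟩
  have hmeas {f : Fin 3 → E3 → ℂ} (hf : ∀ i, IsL2Off (Ω : Set E3) (f i)) (i : Fin 3) :=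
    (hf i).stronglyMeasurable.aestronglyMeasurable (μ := volume)
  simpa only [mul_smul, sub_add_sub_cancel] using hlim₁.add hlim₂
    (hmeas (H.sub H₁).isL2Off_left) (hmeas (H₁.sub H₂).isL2Off_left)
    (hmeas (H.sub H₁).isL2Off_right) (hmeas (H₁.sub H₂).isL2Off_right)

lemma one_sub {v : E3} (hη : ContDiff ℝ ∞ η) (hηs : HasCompactSupport η)
    (hv : ∀ᶠ t : ℝ in 𝓝[>] 0, ∀ y ∈ closure (Ω : Set E3) ∩ tsupport η, y + t • v ∈ Ω) :
    IsHarmlessCutoff Ω lam mu (1 - η) := by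
  intro w L H
  obtain ⟨L', H'⟩ := H.exists_smul hη hηs
  have hw : (fun i => (1 - η) • w i) = w - fun i => η • w i := by
    ext i x
    simp [sub_mul]
  refine ⟨L - L', hw ▸ H.sub (H'.mono Set.inter_subset_left), ?_⟩
  simpa only [hw, sub_sub_cancel] using
    (H'.mono (Set.inter_subset_inter_left _ subset_closure)).isTestLimit_of_eventually_translate
      (hηs.isCompact.inter_left isClosed_closure) hv

lemma exists_eventually_eq_zero (hΩ : HasSegmentProperty (Ω : Set E3)) {x : E3}
    (hx : x ∈ closure (Ω : Set E3)) :
    ∃ η, IsHarmlessCutoff Ω lam mu η ∧ ∀ᶠ y in 𝓝 x, η y = 0 := by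
  obtain ⟨U, hU, v, hv⟩ := hΩ.exists_translation hx
  obtain ⟨r, hr, hrU⟩ := Metric.nhds_basis_closedBall.mem_iff.1 hU
  let ζ : ContDiffBump x := ⟨r / 2, r, half_pos hr, half_lt_self hr⟩
  refine ⟨1 - ζ, one_sub (v := v) ζ.contDiff ζ.hasCompactSupport ?_, ?_⟩
  · filter_upwards [hv] with t ht y hy
    exact ht y ⟨hy.1, hrU (ζ.tsupport_eq ▸ hy.2)⟩
  · filter_upwards [ζ.eventuallyEq_one] with y hy
    simp [hy]

lemma exists_eqOn_zero (hbdd : Bornology.IsBounded (Ω : Set E3))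
    (hΩ : HasSegmentProperty (Ω : Set E3)) :
    ∃ η, IsHarmlessCutoff Ω lam mu η ∧ ∀ x ∈ closure (Ω : Set E3), η x = 0 := by
  refine hbdd.isCompact_closure.induction_on
    (p := fun S => ∃ η, IsHarmlessCutoff Ω lam mu η ∧ ∀ x ∈ S, η x = 0) ?_ ?_ ?_ ?_
  · exact ⟨1, .one, by simp⟩
  · rintro S T hST ⟨η, hη, hηT⟩
    exact ⟨η, hη, fun x hx => hηT x (hST hx)⟩
  · rintro S T ⟨η, hη, hηS⟩ ⟨θ, hθ, hθT⟩
    refine ⟨η * θ, hη.mul hθ, ?_⟩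
    rintro x (hx | hx)
    · simp [hηS x hx]
    · simp [hθT x hx]
  · intro x hx
    obtain ⟨η, hη, hηx⟩ := exists_eventually_eq_zero hΩ hx
    exact ⟨_, mem_nhdsWithin_of_mem_nhds hηx, η, hη, fun y hy => hy⟩

end IsHarmlessCutoff

theorem HasWeakLame.isTestLimit (hbdd : Bornology.IsBounded (Ω : Set E3))
    (hΩ : HasSegmentProperty (Ω : Set E3)) (H : HasWeakLame lam mu Ω w L) :
    IsTestLimit Ω lam mu w L := by
  obtain ⟨η, hη, hη0⟩ := IsHarmlessCutoff.exists_eqOn_zero (lam := lam) (mu := mu) hbdd hΩ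
  obtain ⟨L', H', hlim⟩ := hη w L H
  have hηw : (fun i => η • w i) = 0 := by
    ext i x
    by_cases hx : x ∈ (Ω : Set E3)
    · simp [hη0 x (subset_closure hx)]
    · simp [(H.isL2Off_left i).eq_zero x hx]
  rw [hηw, sub_zero] at hlim
  rw [hηw] at H'
  refine hlim.congr_right fun i => ?_
  filter_upwards [H'.ae_eq_zero i] with x hx
  simp [hx]

end TestApproximation

section SmoothRestriction

open ContDiff

variable {Ω : Opens E3} {f : E3 → ℂ}

/-- The class in `L²(Ω)` of a smooth compactly supported function on `ℝ³`. -/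
def smoothL2 (Ω : Opens E3) (hf : ContDiff ℝ ∞ f) (hfs : HasCompactSupport f) : L2 Ω :=
  ((hf.continuous.memLp_of_hasCompactSupport hfs).restrict (Ω : Set E3)).toLp f

lemma coeFn_smoothL2 (hf : ContDiff ℝ ∞ f) (hfs : HasCompactSupport f) :
    smoothL2 Ω hf hfs =ᵐ[volume.restrict (Ω : Set E3)] f :=
  MemLp.coeFn_toLp _

lemma inner_smoothL2 (hf : ContDiff ℝ ∞ f) (hfs : HasCompactSupport f) (w : L2 Ω) :
    inner ℂ (smoothL2 Ω hf hfs) w = ∫ x in (Ω : Set E3), conj (f x) * w x := by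
  rw [L2.inner_def]
  refine integral_congr_ae ?_
  filter_upwards [coeFn_smoothL2 hf hfs] with x hx
  simp [hx, mul_comm]

lemma test_eq_zero_of_notMem (φ : 𝓓(Ω, ℂ)) {x : E3} (hx : x ∉ (Ω : Set E3)) : φ x = 0 :=
  image_eq_zero_of_notMem_tsupport fun h => hx (φ.tsupport_subset h)

lemma setIntegral_mul_lineDeriv_test (hf : ContDiff ℝ ∞ f) (hfs : HasCompactSupport f)
    (φ : 𝓓(Ω, ℂ)) (j : Fin 3) :
    ∫ x in (Ω : Set E3), f x * (∂_{e j} φ : 𝓓(Ω, ℂ)) x =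
      -∫ x in (Ω : Set E3), pderiv j f x * φ x := by
  rw [setIntegral_eq_integral_of_forall_compl_eq_zero fun x hx => by
      simp [test_eq_zero_of_notMem _ hx],
    setIntegral_eq_integral_of_forall_compl_eq_zero fun x hx => by
      simp [test_eq_zero_of_notMem _ hx], coe_lineDeriv_test]
  have hφ : ContDiff ℝ ∞ φ := φ.contDiff
  have h_int {a b : E3 → ℂ} (ha : Continuous a) (hb : Continuous b) (has : HasCompactSupport a) :
      Integrable (fun x => a x * b x) :=
    (ha.mul hb).integrable_of_hasCompactSupport has.mul_right
  exact integral_mul_fderiv_eq_neg_fderiv_mul_of_integrable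
    (h_int (contDiff_pderiv hf j).continuous φ.continuous (hasCompactSupport_pderiv hfs j))
    (h_int hf.continuous (contDiff_pderiv hφ j).continuous hfs)
    (h_int hf.continuous φ.continuous hfs)
    (fun x _ => hf.differentiable (by simp) x) (fun x _ => hφ.differentiable (by simp) x)

/-- The element of `H¹(Ω)` given by a smooth compactly supported function on `ℝ³`. -/
def smoothH1 (Ω : Opens E3) (hf : ContDiff ℝ ∞ f) (hfs : HasCompactSupport f) : H1 Ω :=
  ⟨WithLp.toLp 2 (smoothL2 Ω hf hfs, WithLp.toLp 2 fun j =>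
    smoothL2 Ω (contDiff_pderiv hf j) (hasCompactSupport_pderiv hfs j)), by
    intro j φ
    have hcoe {g : E3 → ℂ} (hg : ContDiff ℝ ∞ g) (hgs : HasCompactSupport g) (χ : 𝓓(Ω, ℂ)) :
        ∫ x in (Ω : Set E3), smoothL2 Ω hg hgs x * χ x = ∫ x in (Ω : Set E3), g x * χ x :=
      integral_congr_ae ((coeFn_smoothL2 hg hgs).mul .rfl)
    exact (hcoe hf hfs _).trans ((setIntegral_mul_lineDeriv_test hf hfs φ j).trans
      (congrArg Neg.neg
        (hcoe (contDiff_pderiv hf j) (hasCompactSupport_pderiv hfs j) φ).symm))⟩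

lemma fn_smoothH1 (hf : ContDiff ℝ ∞ f) (hfs : HasCompactSupport f) :
    H1.fn (smoothH1 Ω hf hfs) = smoothL2 Ω hf hfs := rfl

lemma pd_smoothH1 (hf : ContDiff ℝ ∞ f) (hfs : HasCompactSupport f) (j : Fin 3) :
    H1.pd j (smoothH1 Ω hf hfs) =
      smoothL2 Ω (contDiff_pderiv hf j) (hasCompactSupport_pderiv hfs j) := rfl

/-- The class in `L²(Ω)` of a test function. -/
def testL2 (φ : 𝓓(Ω, ℂ)) : L2 Ω := smoothL2 Ω φ.contDiff φ.hasCompactSupport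

/-- A test function as an element of `H¹(Ω)`. -/
def testH1 (φ : 𝓓(Ω, ℂ)) : H1 Ω := smoothH1 Ω φ.contDiff φ.hasCompactSupport

lemma coeFn_testL2 (φ : 𝓓(Ω, ℂ)) : testL2 φ =ᵐ[volume.restrict (Ω : Set E3)] φ :=
  coeFn_smoothL2 _ _

lemma fn_testH1 (φ : 𝓓(Ω, ℂ)) : H1.fn (testH1 φ) = testL2 φ := rfl

lemma pd_testH1 (φ : 𝓓(Ω, ℂ)) (j : Fin 3) : H1.pd j (testH1 φ) = testL2 (∂_{e j} φ) := by
  simp only [testH1, pd_smoothH1, testL2, coe_lineDeriv_test]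

lemma isTest_testH1 (φ : 𝓓(Ω, ℂ)) : H1.IsTest (testH1 φ) φ :=
  ⟨coeFn_testL2 φ, fun j => by rw [pd_testH1]; exact coeFn_testL2 _⟩

lemma H1.IsTest.eq_testH1 {u : H1 Ω} {φ : 𝓓(Ω, ℂ)} (h : H1.IsTest u φ) : u = testH1 φ := by
  refine Subtype.ext (WithLp.ofLp_injective 2 (Prod.ext ?_ (PiLp.ext fun j => ?_)))
  · exact Lp.ext (h.1.trans (isTest_testH1 φ).1.symm)
  · exact Lp.ext ((h.2 j).trans ((isTest_testH1 φ).2 j).symm)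

lemma testH1_mem_H10 (φ : 𝓓(Ω, ℂ)) : testH1 φ ∈ H10 Ω :=
  Submodule.le_topologicalClosure _ (Submodule.subset_span ⟨φ, isTest_testH1 φ⟩)

lemma H10_le_ker {F : Type*} [NormedAddCommGroup F] [NormedSpace ℂ F] (T : H1 Ω →L[ℂ] F)
    (hT : ∀ φ : 𝓓(Ω, ℂ), T (testH1 φ) = 0) : H10 Ω ≤ T.ker := by
  refine Submodule.topologicalClosure_minimal _ (Submodule.span_le.2 ?_) T.isClosed_ker
  rintro u ⟨φ, hu⟩
  exact hu.eq_testH1 ▸ hT φ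

lemma inner_testL2 (φ : 𝓓(Ω, ℂ)) (w : L2 Ω) : inner ℂ (testL2 φ) w = pairing w (conjTest φ) :=
  inner_test (testH1 φ) φ (isTest_testH1 φ) w

lemma inner_testL2_lineDeriv (φ : 𝓓(Ω, ℂ)) (v : H1 Ω) (j : Fin 3) :
    inner ℂ (testL2 (∂_{e j} φ)) (H1.fn v) = -inner ℂ (testL2 φ) (H1.pd j v) := by
  rw [inner_testL2, inner_testL2, ← lineDeriv_conjTest, pairing_lineDeriv]

lemma inner_pd_fn_of_mem_H10 {u : H1 Ω} (hu : u ∈ H10 Ω) (v : H1 Ω) (j : Fin 3) :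
    inner ℂ (H1.pd j v) (H1.fn u) = -inner ℂ (H1.fn v) (H1.pd j u) := by
  have hker := H10_le_ker
    ((innerSL ℂ (H1.pd j v)).comp H1.fn + (innerSL ℂ (H1.fn v)).comp (H1.pd j)) (fun φ => ?_) hu
  · simpa [add_eq_zero_iff_eq_neg] using hker
  · have hflip := congrArg conj (inner_testL2_lineDeriv φ v j)
    rw [map_neg, inner_conj_symm, inner_conj_symm] at hflip
    simp [fn_testH1, pd_testH1, hflip]

lemma inner_pd_pd_of_mem_H10 {u : H1 Ω} (hu : u ∈ H10 Ω) (v : H1 Ω) (i j : Fin 3) :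
    inner ℂ (H1.pd i v) (H1.pd j u) = inner ℂ (H1.pd j v) (H1.pd i u) := by
  have hker := H10_le_ker ((innerSL ℂ (H1.pd i v)).comp (H1.pd j) -
    (innerSL ℂ (H1.pd j v)).comp (H1.pd i)) (fun φ => ?_) hu
  · simpa [sub_eq_zero] using hker
  · have hi := inner_testL2_lineDeriv (∂_{e j} φ) v i
    rw [lineDeriv_comm_test, inner_testL2_lineDeriv, neg_inj] at hi
    have hflip := congrArg conj hi
    rw [inner_conj_symm, inner_conj_symm] at hflip
    simp [pd_testH1, hflip]

end SmoothRestriction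

section ZeroExtension

open ContDiff

variable {Ω : Opens E3} {lam mu : ℝ}

/-- Extension by zero. -/
def zeroExt (f : L2 Ω) : E3 → ℂ := (Ω : Set E3).indicator f

lemma isL2Off_zeroExt (f : L2 Ω) : IsL2Off (Ω : Set E3) (zeroExt f) :=
  ⟨(Lp.stronglyMeasurable f).indicator Ω.isOpen.measurableSet,
    (memLp_indicator_iff_restrict Ω.isOpen.measurableSet).2 (Lp.memLp f),
    fun _ hx => Set.indicator_of_notMem hx _⟩

lemma zeroExt_ae_eq (f : L2 Ω) : zeroExt f =ᵐ[volume.restrict (Ω : Set E3)] f :=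
  indicator_ae_eq_restrict Ω.isOpen.measurableSet

lemma hasWeakDiv_of_inner_pd {F : Fin 3 → E3 → ℂ} {h : E3 → ℂ} {F' : Fin 3 → L2 Ω} {h' : L2 Ω}
    (hF : ∀ j, IsL2Off (Ω : Set E3) (F j)) (hh : IsL2Off (Ω : Set E3) h)
    (hFF' : ∀ j, F j =ᵐ[volume.restrict (Ω : Set E3)] F' j)
    (hhh' : h =ᵐ[volume.restrict (Ω : Set E3)] h')
    (H : ∀ u : H1 Ω, ∑ j, inner ℂ (H1.pd j u) (F' j) = -inner ℂ (H1.fn u) h') :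
    HasWeakDiv (Ω : Set E3) F h := by
  refine ⟨hF, hh, fun φ hφ hφs => ?_⟩
  have hφc : ContDiff ℝ ∞ fun x => (φ x : ℂ) := Complex.ofRealCLM.contDiff.comp hφ
  have hφcs : HasCompactSupport fun x => (φ x : ℂ) :=
    hφs.comp_left (g := ((↑) : ℝ → ℂ)) Complex.ofReal_zero
  have hpderiv (j : Fin 3) (x : E3) :
      pderiv j (fun x => (φ x : ℂ)) x = ((pderiv j φ x : ℝ) : ℂ) := by
    have hd := Complex.ofRealCLM.hasFDerivAt.comp x (hφ.differentiable (by simp) x).hasFDerivAt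
    exact congrArg (· (EuclideanSpace.single j 1)) hd.fderiv
  have hpair {ψ : E3 → ℝ} {g : E3 → ℂ} {g' : L2 Ω} (hg : IsL2Off (Ω : Set E3) g)
      (hgg' : g =ᵐ[volume.restrict (Ω : Set E3)] g') :
      ∫ x, ψ x • g x = ∫ x in (Ω : Set E3), conj (ψ x : ℂ) * g' x := by
    rw [← setIntegral_eq_integral_of_forall_compl_eq_zero (s := (Ω : Set E3))
      fun x hx => by simp [hg.eq_zero x hx]]
    refine integral_congr_ae ?_
    filter_upwards [hgg'] with x hx
    simp [hx]
  have key := H (smoothH1 Ω hφc hφcs)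
  simp only [pd_smoothH1, fn_smoothH1, inner_smoothL2, hpderiv] at key
  simpa only [hpair (hF _) (hFF' _), hpair hh hhh'] using key

lemma hasWeakPartial_zeroExt {u : H1 Ω} (hu : u ∈ H10 Ω) (j : Fin 3) :
    HasWeakPartial (Ω : Set E3) j (zeroExt (H1.fn u)) (zeroExt (H1.pd j u)) := by
  refine hasWeakDiv_of_inner_pd (F' := Pi.single j (H1.fn u)) ?_ (isL2Off_zeroExt _) ?_
    (zeroExt_ae_eq _) fun v => ?_
  · exact fun k => by
      rcases eq_or_ne k j with rfl | hk
      · simpa using isL2Off_zeroExt _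
      · simpa [hk] using IsL2Off.zero
  · intro k
    rcases eq_or_ne k j with rfl | hk
    · simpa using zeroExt_ae_eq _
    · simpa [hk] using (Lp.coeFn_zero ℂ 2 (volume.restrict (Ω : Set E3))).symm
  · rw [Finset.sum_eq_single j (fun k _ hk => by simp [hk]) (by simp), Pi.single_eq_same,
      inner_pd_fn_of_mem_H10 hu]

lemma stress_eq_stressOf (u : H1v Ω) :
    stress lam mu u = stressOf lam mu fun i j => H1.pd j (u i) := by
  ext1 i
  ext1 j
  simp only [stress, stressOf, Complex.coe_smul]
  rfl

lemma ae_eq_coeFn_sum {κ α : Type*} [MeasurableSpace α] {p : ℝ≥0∞} {μ : Measure α}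
    (s : Finset κ) {F : κ → α → ℂ} {D : κ → Lp ℂ p μ} (hFD : ∀ k, F k =ᵐ[μ] D k) :
    ∑ k ∈ s, F k =ᵐ[μ] ⇑(∑ k ∈ s, D k) := by
  classical
  induction s using Finset.induction_on with
  | empty => exact (Lp.coeFn_zero _ _ _).symm
  | insert a s ha ih =>
    rw [Finset.sum_insert ha, Finset.sum_insert ha]
    exact ((hFD a).add ih).trans (Lp.coeFn_add _ _).symm

lemma ae_eq_coeFn_stressOf {ι α : Type*} [Fintype ι] [DecidableEq ι] [MeasurableSpace α] {p : ℝ≥0∞}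
    {μ : Measure α} {F : ι → ι → α → ℂ} {D : ι → ι → Lp ℂ p μ} (hFD : ∀ i j, F i j =ᵐ[μ] D i j)
    (i j : ι) : stressOf lam mu F i j =ᵐ[μ] ⇑(stressOf lam mu D i j) := by
  refine .trans (.add ?_ (((hFD i j).add (hFD j i)).const_smul mu |>.trans ?_))
    (Lp.coeFn_add _ _).symm
  · split_ifs
    · exact ((ae_eq_coeFn_sum Finset.univ fun k => hFD k k).const_smul lam).trans
        (Lp.coeFn_smul lam _).symm
    · exact (Lp.coeFn_zero _ _ _).symm
  · exact ((Lp.coeFn_add _ _).symm.const_smul mu).trans (Lp.coeFn_smul mu _).symm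

lemma hasWeakLame_zeroExt {u : HLame Ω lam mu} (hu0 : ∀ i, HLame.toH1v u i ∈ H10 Ω)
    (hu1 : ∀ i v, greenForm u i v = 0) :
    HasWeakLame lam mu (Ω : Set E3) (fun i => zeroExt (H1.fn (HLame.toH1v u i)))
      (fun i => zeroExt (HLame.lame u i)) := by
  have hgrad (i j : Fin 3) := hasWeakPartial_zeroExt (hu0 i) j
  refine ⟨fun i j => zeroExt (H1.pd j (HLame.toH1v u i)), hgrad, fun i => ?_⟩
  refine hasWeakDiv_of_inner_pd (F' := stress lam mu (HLame.toH1v u) i) (fun j => ?_)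
    (isL2Off_zeroExt _) (fun j => ?_) (zeroExt_ae_eq _) fun v => ?_
  · exact .stressOf (fun i j => isL2Off_zeroExt _) i j
  · rw [stress_eq_stressOf]
    exact ae_eq_coeFn_stressOf (fun i j => zeroExt_ae_eq _) i j
  · rw [← add_eq_zero_iff_eq_neg, ← hu1 i v]
    simp [greenForm]

/-- A vector test field as an element of `(L²(Ω))³`. -/
def testField (Φ : Fin 3 → 𝓓(Ω, ℂ)) : L2v Ω := WithLp.toLp 2 fun i => testL2 (Φ i)

lemma edist_testL2_le (φ : 𝓓(Ω, ℂ)) (f : L2 Ω) :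
    edist (testL2 φ) f ≤ eLpNorm (⇑φ - zeroExt f) 2 volume := by
  rw [Lp.edist_def]
  exact (eLpNorm_congr_ae ((coeFn_testL2 φ).sub (zeroExt_ae_eq f).symm)).trans_le
    (eLpNorm_mono_measure _ Measure.restrict_le_self)

theorem mem_closure_range_testField (hbdd : Bornology.IsBounded (Ω : Set E3))
    (hΩ : HasSegmentProperty (Ω : Set E3)) {u : HLame Ω lam mu}
    (hu0 : ∀ i, HLame.toH1v u i ∈ H10 Ω) (hu1 : ∀ i v, greenForm u i v = 0) :
    (H1v.fn (HLame.toH1v u), HLame.lame u) ∈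
      closure (Set.range fun Φ : Fin 3 → 𝓓(Ω, ℂ) =>
        (testField Φ, testField (lameTest lam mu Φ))) := by
  have hcomp : (fun i => (H1.fn (HLame.toH1v u i), HLame.lame u i)) ∈
      closure (Set.range fun (Φ : Fin 3 → 𝓓(Ω, ℂ)) i =>
        (testL2 (Φ i), testL2 (lameTest lam mu Φ i))) := by
    refine EMetric.mem_closure_iff.2 fun ε hε => ?_
    obtain ⟨δ, hδ, hδε⟩ := exists_between hε
    obtain ⟨Φ, hΦ⟩ := (hasWeakLame_zeroExt hu0 hu1).isTestLimit hbdd hΩ δ hδ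
    refine ⟨_, ⟨Φ, rfl⟩, lt_of_le_of_lt ?_ hδε⟩
    rw [edist_comm]
    exact edist_pi_le_iff.2 fun i => max_le ((edist_testL2_le _ _).trans (hΦ i).1)
      ((edist_testL2_le _ _).trans (hΦ i).2)
  let toFields (p : Fin 3 → L2 Ω × L2 Ω) : L2v Ω × L2v Ω :=
    (WithLp.toLp 2 fun i => (p i).1, WithLp.toLp 2 fun i => (p i).2)
  have hcont : Continuous toFields := by fun_prop
  refine map_mem_closure (f := toFields) hcont hcomp ?_
  rintro _ ⟨Φ, rfl⟩
  exact ⟨Φ, rfl⟩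

end ZeroExtension

section WeakEquation

variable {Ω : Opens E3} {lam mu : ℝ}

lemma conjTest_involutive : Function.Involutive (conjTest : 𝓓(Ω, ℂ) → 𝓓(Ω, ℂ)) :=
  fun φ => by ext x; simp [conjTest_apply]

lemma lameTest_conjTest (Φ : Fin 3 → 𝓓(Ω, ℂ)) (i : Fin 3) :
    lameTest lam mu (fun k => conjTest (Φ k)) i = conjTest (lameTest lam mu Φ i) := by
  ext x
  simp [lameTest, lineDeriv_conjTest, conjTest_apply, Fin.sum_univ_three]

lemma isWeakPartial_iff_inner {j : Fin 3} {u v : L2 Ω} :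
    IsWeakPartial j u v ↔
      ∀ φ : 𝓓(Ω, ℂ), inner ℂ (testL2 (∂_{e j} φ)) u = -inner ℂ (testL2 φ) v := by
  simp only [inner_testL2, ← lineDeriv_conjTest]
  exact conjTest_involutive.surjective.forall

lemma inner_testField (Φ : Fin 3 → 𝓓(Ω, ℂ)) (u : L2v Ω) :
    inner ℂ (testField Φ) u = ∑ i, pairing (u i) (conjTest (Φ i)) := by
  simp only [PiLp.inner_apply, testField, inner_testL2]

lemma isWeakLame_iff_inner {u g : L2v Ω} {g' : Fin 3 → E3 → ℂ}
    (hg : ∀ i, g' i =ᵐ[volume.restrict (Ω : Set E3)] g i) :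
    IsWeakLame lam mu u g' ↔ ∀ Φ : Fin 3 → 𝓓(Ω, ℂ),
      inner ℂ (testField (lameTest lam mu Φ)) u = inner ℂ (testField Φ) g := by
  have hpair (Φ : Fin 3 → 𝓓(Ω, ℂ)) :
      ∑ i, ∫ x in (Ω : Set E3), g' i x * Φ i x = ∑ i, pairing (g i) (Φ i) :=
    Finset.sum_congr rfl fun i _ => integral_congr_ae ((hg i).mul .rfl)
  simp only [IsWeakLame, hpair, inner_testField, ← lameTest_conjTest]
  exact conjTest_involutive.surjective.comp_left.forall

lemma isClosed_H1 : IsClosed (H1 Ω : Set (WithLp 2 (L2 Ω × L2v Ω))) := by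
  have hset : (H1 Ω : Set (WithLp 2 (L2 Ω × L2v Ω))) = ⋂ (j : Fin 3) (φ : 𝓓(Ω, ℂ)),
      {p | inner ℂ (testL2 (∂_{e j} φ)) p.fst = -inner ℂ (testL2 φ) (p.snd j)} := by
    ext p
    simp only [Set.mem_iInter, Set.mem_ofPred_eq, ← isWeakPartial_iff_inner]
    rfl
  rw [hset]
  exact isClosed_iInter fun j => isClosed_iInter fun φ =>
    isClosed_eq (by fun_prop) (by fun_prop)

instance : CompleteSpace (H1 Ω) := isClosed_H1.completeSpace_coe

lemma continuous_H1v_fn : Continuous (H1v.fn : H1v Ω → L2v Ω) := by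
  unfold H1v.fn
  fun_prop

lemma isClosed_HLame : IsClosed (HLame Ω lam mu : Set (WithLp 2 (H1v Ω × L2v Ω))) := by
  have hset : (HLame Ω lam mu : Set (WithLp 2 (H1v Ω × L2v Ω))) = ⋂ (Φ : Fin 3 → 𝓓(Ω, ℂ)),
      {p | inner ℂ (testField (lameTest lam mu Φ)) (H1v.fn p.fst) =
        inner ℂ (testField Φ) p.snd} := by
    ext p
    simp only [Set.mem_iInter, Set.mem_ofPred_eq]
    exact isWeakLame_iff_inner fun i => ae_eq_rfl
  rw [hset]
  have hfn : Continuous fun p : WithLp 2 (H1v Ω × L2v Ω) => H1v.fn p.fst :=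
    continuous_H1v_fn.comp (WithLp.fstL 2 ℂ (H1v Ω) (L2v Ω)).continuous
  exact isClosed_iInter fun Φ => isClosed_eq (by fun_prop) (by fun_prop)

-- Extending the seminorm directly keeps the instance problems about `ℋ(Ω)` small: along Mathlib's
-- path, the three nested levels of products and subspaces are compared componentwise. The instances
-- are scoped: statements outside this namespace use Mathlib's norm, which agrees definitionally.
scoped instance : NormedAddCommGroup (HLame Ω lam mu) :=
  { Submodule.seminormedAddCommGroup (HLame Ω lam mu) with
    eq_of_dist_eq_zero := eq_of_dist_eq_zero }

scoped instance : InnerProductSpace ℂ (WithLp 2 (H1v Ω × L2v Ω)) := WithLp.instProdInnerProductSpace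

scoped instance : InnerProductSpace ℂ (HLame Ω lam mu) :=
  Submodule.innerProductSpace (HLame Ω lam mu)

scoped instance : NormedSpace ℂ (HLame Ω lam mu) := InnerProductSpace.toNormedSpace

instance : CompleteSpace (HLame Ω lam mu) := isClosed_HLame.completeSpace_coe

end WeakEquation

section ZeroData

variable {Ω : Opens E3} {lam mu : ℝ}

lemma stressOf_clm_apply {ι M N : Type*} [Fintype ι] [DecidableEq ι] [AddCommGroup M]
    [TopologicalSpace M] [Module ℂ M] [NormedAddCommGroup N] [NormedSpace ℂ N] [NormedSpace ℝ N]
    [SMulCommClass ℂ ℝ N] (A : ι → ι → M →L[ℂ] N) (u : M) (i j : ι) :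
    stressOf lam mu A i j u = stressOf lam mu (fun i j => A i j u) i j := by
  simp only [stressOf]
  split_ifs <;> simp

namespace HLame

/-- The `i`-th component of a field in `ℋ(Ω)`, as an element of `H¹(Ω)`. -/
def compL (i : Fin 3) : HLame Ω lam mu →L[ℂ] H1 Ω :=
  (PiLp.proj 2 (𝕜 := ℂ) (fun _ : Fin 3 => H1 Ω) i).comp
    ((WithLp.fstL 2 ℂ (H1v Ω) (L2v Ω)).comp (HLame Ω lam mu).subtypeL)

/-- The embedding of `ℋ(Ω)` into `(L²(Ω))³`. -/
def fnL : HLame Ω lam mu →L[ℂ] L2v Ω :=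
  (PiLp.continuousLinearEquiv 2 ℂ fun _ : Fin 3 => L2 Ω).symm.toContinuousLinearMap.comp
    (.pi fun i => H1.fn.comp (compL i))

/-- The Lamé operator `Δ*` from `ℋ(Ω)` to `(L²(Ω))³`. -/
def lameL : HLame Ω lam mu →L[ℂ] L2v Ω :=
  (WithLp.sndL 2 ℂ (H1v Ω) (L2v Ω)).comp (HLame Ω lam mu).subtypeL

/-- Green's form as a continuous linear functional of the field. -/
def greenL (i : Fin 3) (v : H1 Ω) : HLame Ω lam mu →L[ℂ] ℂ :=
  (∑ j, (innerSL ℂ (H1.pd j v)).comp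
      (stressOf lam mu (fun i j => (H1.pd j).comp (compL i)) i j)) +
    (innerSL ℂ (H1.fn v)).comp ((PiLp.proj 2 (𝕜 := ℂ) (fun _ : Fin 3 => L2 Ω) i).comp lameL)

lemma greenForm_apply (u : HLame Ω lam mu) (i : Fin 3) (v : H1 Ω) :
    greenForm u i v = (∑ j, inner ℂ (H1.pd j v) (stress lam mu (toH1v u) i j)) +
      inner ℂ (H1.fn v) (lame u i) := by
  simp [greenForm]

lemma greenL_apply (i : Fin 3) (v : H1 Ω) (u : HLame Ω lam mu) :
    greenL i v u = greenForm u i v := by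
  have hstress (j : Fin 3) :
      stressOf lam mu (fun i j => (H1.pd j).comp (compL i)) i j u =
        stress lam mu (toH1v u) i j := by
    rw [stress_eq_stressOf]
    exact stressOf_clm_apply _ u i j
  simp only [greenL, add_apply, sum_apply, ContinuousLinearMap.comp_apply, innerSL_apply_apply,
    hstress, greenForm_apply]
  rfl

end HLame

/-- The fields in `ℋ(Ω)` with vanishing Cauchy data. -/
def zeroData (Ω : Opens E3) (lam mu : ℝ) : Submodule ℂ (HLame Ω lam mu) :=
  (⨅ i, (H10 Ω).comap (HLame.compL i).toLinearMap) ⊓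
    ⨅ (i : Fin 3) (v : H1 Ω), (HLame.greenL i v).ker

lemma mem_zeroData {u : HLame Ω lam mu} :
    u ∈ zeroData Ω lam mu ↔ (∀ i, HLame.toH1v u i ∈ H10 Ω) ∧ ∀ i v, greenForm u i v = 0 := by
  simp only [zeroData, Submodule.mem_inf, Submodule.mem_iInf, Submodule.mem_comap,
    LinearMap.mem_ker, ContinuousLinearMap.coe_coe, HLame.greenL_apply]
  rfl

lemma isClosed_zeroData : IsClosed (zeroData Ω lam mu : Set (HLame Ω lam mu)) := by
  simp only [zeroData, Submodule.coe_inf, Submodule.coe_iInf]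
  refine (isClosed_iInter fun i => ?_).inter
    (isClosed_iInter fun i => isClosed_iInter fun v => (HLame.greenL i v).isClosed_ker)
  exact (Submodule.isClosed_topologicalClosure _).preimage (HLame.compL i).continuous

instance : CompleteSpace (zeroData Ω lam mu) := isClosed_zeroData.completeSpace_coe

lemma sub_mem_zeroData_iff {u v : HLame Ω lam mu} :
    u - v ∈ zeroData Ω lam mu ↔ trace0 (HLame.toH1v u) = trace0 (HLame.toH1v v) ∧
      trace1 u = trace1 v := by
  have hgreen (i : Fin 3) (w : H1 Ω) :
      greenForm (u - v) i w = greenForm u i w - greenForm v i w := by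
    simp only [← HLame.greenL_apply, map_sub]
  simp only [mem_zeroData, hgreen, sub_eq_zero, funext_iff]
  refine and_congr (forall_congr' fun i => (Submodule.Quotient.eq (H10 Ω)).symm)
    (forall_congr' fun i => ?_)
  rw [DFunLike.ext_iff]
  exact ((H10 Ω).mkQ_surjective.forall (p := fun x => trace1 u i x = trace1 v i x)).symm

end ZeroData

section StressEnergy

variable {ι N : Type*} [Fintype ι] [DecidableEq ι] [NormedAddCommGroup N]
  [InnerProductSpace ℂ N] {lam mu : ℝ}

lemma sum_inner_stressOf (D D' : ι → ι → N) :
    ∑ i, ∑ j, inner ℂ (D i j) (stressOf lam mu D' i j) =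
      lam * inner ℂ (∑ i, D i i) (∑ i, D' i i) + mu * ((∑ i, ∑ j, inner ℂ (D i j) (D' i j)) +
        ∑ i, ∑ j, inner ℂ (D i j) (D' j i)) := by
  have hdiag (i j : ι) : inner ℂ (D i j) (if i = j then lam • ∑ k, D' k k else 0) =
      if i = j then lam * inner ℂ (D i i) (∑ k, D' k k) else 0 := by
    split_ifs with h
    · rw [h, inner_smul_right_eq_smul, Complex.real_smul]
    · exact inner_zero_right _
  simp only [stressOf, inner_add_right, hdiag, inner_smul_right_eq_smul, Complex.real_smul,
    Finset.sum_add_distrib, Finset.sum_ite_eq, Finset.mem_univ, if_true, ← Finset.mul_sum,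
    ← sum_inner, mul_add]

lemma conj_sum_inner_stressOf (D D' : ι → ι → N) :
    conj (∑ i, ∑ j, inner ℂ (D i j) (stressOf lam mu D' i j)) =
      ∑ i, ∑ j, inner ℂ (D' i j) (stressOf lam mu D i j) := by
  simp only [sum_inner_stressOf, map_add, map_mul, map_sum, Complex.conj_ofReal, inner_conj_symm]
  rw [Finset.sum_comm (f := fun i j => inner ℂ (D' j i) (D i j))]

end StressEnergy

section TestFieldsInHLame

variable {Ω : Opens E3} {lam mu : ℝ}

/-- `testL2` as a real-linear map. -/
def testL2Linear (Ω : Opens E3) : 𝓓(Ω, ℂ) →ₗ[ℝ] L2 Ω where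
  toFun := testL2
  map_add' _ _ := rfl
  map_smul' c φ := by
    refine Lp.ext ((coeFn_testL2 _).trans (.trans ?_ (Lp.coeFn_smul _ _).symm))
    exact ((coeFn_testL2 φ).const_smul c).symm

lemma testL2_stressOf (Φ : Fin 3 → 𝓓(Ω, ℂ)) (i j : Fin 3) :
    testL2 (stressOf lam mu (fun i j => ∂_{e j} (Φ i)) i j) =
      stress lam mu (WithLp.toLp 2 fun i => testH1 (Φ i)) i j := by
  simp only [stress_eq_stressOf, pd_testH1]
  exact map_stressOf lam mu (testL2Linear Ω) _ i j

lemma inner_fn_testL2_lameTest (v : H1 Ω) (Φ : Fin 3 → 𝓓(Ω, ℂ)) (i : Fin 3) :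
    inner ℂ (H1.fn v) (testL2 (lameTest lam mu Φ i)) =
      -∑ j, inner ℂ (H1.pd j v)
        (stress lam mu (WithLp.toLp 2 fun i => testH1 (Φ i)) i j) := by
  have hparts (φ : 𝓓(Ω, ℂ)) (j : Fin 3) :
      inner ℂ (H1.pd j v) (testL2 φ) = -inner ℂ (H1.fn v) (testL2 (∂_{e j} φ)) := by
    rw [← pd_testH1, ← fn_testH1]
    exact inner_pd_fn_of_mem_H10 (testH1_mem_H10 φ) v j
  simp only [← testL2_stressOf, hparts, Finset.sum_neg_distrib, neg_neg, ← inner_sum]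
  rw [lameTest_eq_sum_lineDeriv]
  exact congrArg _ (map_sum (testL2Linear Ω) _ _)

lemma inner_testField_lameTest_comm (Ψ Φ : Fin 3 → 𝓓(Ω, ℂ)) :
    inner ℂ (testField (lameTest lam mu Ψ)) (testField Φ) =
      inner ℂ (testField Ψ) (testField (lameTest lam mu Φ)) := by
  let grad (Φ : Fin 3 → 𝓓(Ω, ℂ)) (i j : Fin 3) : L2 Ω := testL2 (∂_{e j} (Φ i))
  have hgreen (Ψ Φ : Fin 3 → 𝓓(Ω, ℂ)) :
      inner ℂ (testField Ψ) (testField (lameTest lam mu Φ)) =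
        -∑ i, ∑ j, inner ℂ (grad Ψ i j) (stressOf lam mu (grad Φ) i j) := by
    rw [PiLp.inner_apply, ← Finset.sum_neg_distrib]
    refine Finset.sum_congr rfl fun i _ => ?_
    refine (inner_fn_testL2_lameTest (testH1 (Ψ i)) Φ i).trans ?_
    simp only [stress_eq_stressOf, pd_testH1, grad]
  rw [← inner_conj_symm, hgreen, hgreen, map_neg]
  exact congrArg Neg.neg (conj_sum_inner_stressOf (grad Φ) (grad Ψ))

/-- A test field as an element of `ℋ(Ω)`. -/
def testHLame (lam mu : ℝ) (Φ : Fin 3 → 𝓓(Ω, ℂ)) : HLame Ω lam mu :=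
  ⟨WithLp.toLp 2 (WithLp.toLp 2 fun i => testH1 (Φ i), testField (lameTest lam mu Φ)),
    (isWeakLame_iff_inner (u := testField Φ) fun _ => ae_eq_rfl).2
      fun Ψ => inner_testField_lameTest_comm Ψ Φ⟩

lemma testHLame_mem_zeroData (Φ : Fin 3 → 𝓓(Ω, ℂ)) :
    testHLame lam mu Φ ∈ zeroData Ω lam mu := by
  refine mem_zeroData.2 ⟨fun i => testH1_mem_H10 _, fun i v => ?_⟩
  exact (HLame.greenForm_apply _ i v).trans (add_eq_zero_iff_eq_neg'.2
    (inner_fn_testL2_lameTest v Φ i))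

end TestFieldsInHLame

section Korn

variable {ι N : Type*} [Fintype ι] [NormedAddCommGroup N] [InnerProductSpace ℂ N] {lam mu : ℝ}

lemma sum_inner_swap_eq_norm_sq {D : ι → ι → N}
    (hD : ∀ i j, inner ℂ (D i j) (D j i) = inner ℂ (D i i) (D j j)) :
    ∑ i, ∑ j, inner ℂ (D i j) (D j i) = (‖∑ i, D i i‖ ^ 2 : ℝ) := by
  simp only [hD, ← inner_sum, ← sum_inner, inner_self_eq_norm_sq_to_K]
  simp

lemma norm_sum_diag_sq_le {D : ι → ι → N}
    (hD : ∀ i j, inner ℂ (D i j) (D j i) = inner ℂ (D i i) (D j j)) :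
    ‖∑ i, D i i‖ ^ 2 ≤ ∑ i, ∑ j, ‖D i j‖ ^ 2 := by
  have hpair (i j : ι) : (inner ℂ (D i j) (D j i)).re ≤ (‖D i j‖ ^ 2 + ‖D j i‖ ^ 2) / 2 := by
    have hcs : (inner ℂ (D i j) (D j i)).re ≤ ‖D i j‖ * ‖D j i‖ :=
      re_inner_le_norm (𝕜 := ℂ) (D i j) (D j i)
    linarith [two_mul_le_add_sq ‖D i j‖ ‖D j i‖]
  calc ‖∑ i, D i i‖ ^ 2 = ∑ i, ∑ j, (inner ℂ (D i j) (D j i)).re := by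
        simp only [← Complex.re_sum, sum_inner_swap_eq_norm_sq hD, Complex.ofReal_re]
    _ ≤ ∑ i, ∑ j, (‖D i j‖ ^ 2 + ‖D j i‖ ^ 2) / 2 :=
        Finset.sum_le_sum fun i _ => Finset.sum_le_sum fun j _ => hpair i j
    _ = ∑ i, ∑ j, ‖D i j‖ ^ 2 := by
        simp only [← Finset.sum_div, Finset.sum_add_distrib]
        rw [Finset.sum_comm (f := fun i j => ‖D j i‖ ^ 2)]
        ring

lemma sum_inner_stressOf_self [DecidableEq ι] {D : ι → ι → N}
    (hD : ∀ i j, inner ℂ (D i j) (D j i) = inner ℂ (D i i) (D j j)) :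
    ∑ i, ∑ j, inner ℂ (D i j) (stressOf lam mu D i j) =
      ((lam + mu) * ‖∑ i, D i i‖ ^ 2 + mu * ∑ i, ∑ j, ‖D i j‖ ^ 2 : ℝ) := by
  rw [sum_inner_stressOf, sum_inner_swap_eq_norm_sq hD]
  simp only [inner_self_eq_norm_sq_to_K]
  push_cast [Complex.coe_algebraMap]
  ring

lemma min_mul_le_add_mul {d S : ℝ} (hmu : 0 < mu) (hd : 0 ≤ d) (hdS : d ≤ S) :
    min mu (3 * lam + 2 * mu) * S ≤ (lam + mu) * d + mu * S := by
  rcases le_or_gt 0 (lam + mu) with h | h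
  · nlinarith [mul_le_mul_of_nonneg_right (min_le_left mu (3 * lam + 2 * mu)) (hd.trans hdS)]
  · have hmin : min mu (3 * lam + 2 * mu) ≤ lam + 2 * mu := (min_le_right _ _).trans (by linarith)
    nlinarith [mul_le_mul_of_nonneg_right hmin (hd.trans hdS)]

theorem min_mul_sum_norm_sq_le_re_sum_inner_stressOf [DecidableEq ι] {D : ι → ι → N}
    (hmu : 0 < mu) (hD : ∀ i j, inner ℂ (D i j) (D j i) = inner ℂ (D i i) (D j j)) :
    min mu (3 * lam + 2 * mu) * ∑ i, ∑ j, ‖D i j‖ ^ 2 ≤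
      (∑ i, ∑ j, inner ℂ (D i j) (stressOf lam mu D i j)).re := by
  rw [sum_inner_stressOf_self hD, Complex.ofReal_re]
  exact min_mul_le_add_mul hmu (sq_nonneg _) (norm_sum_diag_sq_le hD)

end Korn

section ZeroDataEstimates

variable {Ω : Opens E3} {lam mu : ℝ}

theorem dirichletEigenvalue_mul_norm_sq_le {u : H1 Ω} (hu : u ∈ H10 Ω) :
    dirichletEigenvalue Ω * ‖H1.fn u‖ ^ 2 ≤ ∑ j, ‖H1.pd j u‖ ^ 2 := by
  by_cases h : H1.fn u = 0
  · simp only [h, norm_zero, ne_eq, OfNat.ofNat_ne_zero, not_false_eq_true, zero_pow, mul_zero]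
    positivity
  · rw [← le_div_iff₀ (by positivity)]
    refine csInf_le ⟨0, ?_⟩ ⟨u, hu, h, rfl⟩
    rintro r ⟨v, -, -, rfl⟩
    positivity

namespace HLame

lemma norm_sq_eq (u : HLame Ω lam mu) :
    ‖u‖ ^ 2 = ‖fnL u‖ ^ 2 + (∑ i, ∑ j, ‖H1.pd j (toH1v u i)‖ ^ 2) + ‖lameL u‖ ^ 2 := by
  have hprod : ‖u‖ ^ 2 = ‖toH1v u‖ ^ 2 + ‖lameL u‖ ^ 2 :=
    WithLp.prod_norm_sq_eq_of_L2 (u : WithLp 2 (H1v Ω × L2v Ω))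
  have hH1 (v : H1 Ω) : ‖v‖ ^ 2 = ‖H1.fn v‖ ^ 2 + ∑ j, ‖H1.pd j v‖ ^ 2 :=
    (WithLp.prod_norm_sq_eq_of_L2 (v : WithLp 2 (L2 Ω × L2v Ω))).trans
      (congrArg _ (PiLp.norm_sq_eq_of_L2 _ _))
  have hfn : ‖fnL u‖ ^ 2 = ∑ i, ‖H1.fn (toH1v u i)‖ ^ 2 := PiLp.norm_sq_eq_of_L2 _ (fnL u)
  rw [hprod, hfn, PiLp.norm_sq_eq_of_L2 _ (toH1v u)]
  simp only [hH1, Finset.sum_add_distrib]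

end HLame

variable {u : HLame Ω lam mu}

lemma inner_fnL_lameL_of_mem_zeroData (hu : u ∈ zeroData Ω lam mu) :
    inner ℂ (HLame.fnL u) (HLame.lameL u) = -∑ i, ∑ j,
      inner ℂ (H1.pd j (HLame.toH1v u i)) (stress lam mu (HLame.toH1v u) i j) := by
  rw [PiLp.inner_apply, ← Finset.sum_neg_distrib]
  refine Finset.sum_congr rfl fun i _ => eq_neg_of_add_eq_zero_right ?_
  exact (HLame.greenForm_apply u i _).symm.trans ((mem_zeroData.1 hu).2 i _)

theorem korn_zeroData (hmu : 0 < mu) (hu : u ∈ zeroData Ω lam mu) :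
    min mu (3 * lam + 2 * mu) * (∑ i, ∑ j, ‖H1.pd j (HLame.toH1v u i)‖ ^ 2) ≤
      -(inner ℂ (HLame.fnL u) (HLame.lameL u)).re := by
  rw [inner_fnL_lameL_of_mem_zeroData hu, Complex.neg_re, neg_neg, stress_eq_stressOf]
  exact min_mul_sum_norm_sq_le_re_sum_inner_stressOf hmu fun i j =>
    (inner_pd_pd_of_mem_H10 ((mem_zeroData.1 hu).1 j) _ i j).symm

theorem poincare_zeroData (hmu : 0 < mu) (hlam : 0 ≤ 3 * lam + 2 * mu)
    (hu : u ∈ zeroData Ω lam mu) :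
    min mu (3 * lam + 2 * mu) * dirichletEigenvalue Ω * ‖HLame.fnL u‖ ^ 2 ≤
      -(inner ℂ (HLame.fnL u) (HLame.lameL u)).re := by
  refine le_trans ?_ (korn_zeroData hmu hu)
  rw [mul_assoc]
  refine mul_le_mul_of_nonneg_left ?_ (le_min hmu.le hlam)
  rw [PiLp.norm_sq_eq_of_L2, Finset.mul_sum]
  exact Finset.sum_le_sum fun i _ => dirichletEigenvalue_mul_norm_sq_le ((mem_zeroData.1 hu).1 i)

lemma exists_mul_norm_sq_le_of_mem_zeroData (hmu : 0 < mu) (hlam : 0 < 3 * lam + 2 * mu) :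
    ∃ κ > 0, ∀ u ∈ zeroData Ω lam mu,
      κ * ‖u‖ ^ 2 ≤ ‖HLame.fnL u‖ ^ 2 + ‖HLame.lameL u‖ ^ 2 := by
  have hm : 0 < min mu (3 * lam + 2 * mu) := lt_min hmu hlam
  generalize hm_def : min mu (3 * lam + 2 * mu) = m at hm
  have habsorb {a b G : ℝ} (h : m * G ≤ a * b) :
      2 * m / (2 * m + 1) * (a ^ 2 + G + b ^ 2) ≤ a ^ 2 + b ^ 2 := by
    rw [div_mul_eq_mul_div, div_le_iff₀ (by positivity)]
    linarith [two_mul_le_add_sq a b]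
  refine ⟨2 * m / (2 * m + 1), by positivity, fun u hu => ?_⟩
  have hcs : -(inner ℂ (HLame.fnL u) (HLame.lameL u)).re ≤ ‖HLame.fnL u‖ * ‖HLame.lameL u‖ :=
    (neg_le_abs _).trans ((Complex.abs_re_le_norm _).trans (norm_inner_le_norm _ _))
  have hgrad := (korn_zeroData hmu hu).trans hcs
  rw [hm_def] at hgrad
  exact (congrArg _ (HLame.norm_sq_eq u)).trans_le (habsorb hgrad)

end ZeroDataEstimates

section Multiplication

variable {α ι : Type*} [MeasurableSpace α] {μ : Measure α} [Fintype ι] {r s : α → ℝ} {c : ℝ}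

/-- Multiplication by the bounded real function `r` on `L²`. -/
def mulLp (r : α → ℝ) (hr : MemLp r ⊤ μ) : Lp ℂ 2 μ →L[ℂ] Lp ℂ 2 μ :=
  (ContinuousLinearMap.mul ℂ ℂ).holderL μ ⊤ 2 2 ((hr.ofReal (K := ℂ)).toLp _)

lemma coeFn_mulLp (hr : MemLp r ⊤ μ) (u : Lp ℂ 2 μ) :
    mulLp r hr u =ᵐ[μ] fun x => (r x : ℂ) * u x := by
  have h := (ContinuousLinearMap.mul ℂ ℂ).coeFn_holder (r := 2) ((hr.ofReal (K := ℂ)).toLp _) u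
  filter_upwards [h, (hr.ofReal (K := ℂ)).coeFn_toLp] with x hx hrx
  exact hx.trans (congrArg (· * u x) hrx)

lemma inner_mulLp_comm (hr : MemLp r ⊤ μ) (u v : Lp ℂ 2 μ) :
    inner ℂ (mulLp r hr u) v = inner ℂ u (mulLp r hr v) := by
  rw [L2.inner_def, L2.inner_def]
  refine integral_congr_ae ?_
  filter_upwards [coeFn_mulLp hr u, coeFn_mulLp hr v] with x hu hv
  simp only [hu, RCLike.inner_apply, map_mul, Complex.conj_ofReal, hv]
  ring

lemma re_inner_mulLp_mono (hr : MemLp r ⊤ μ) (hs : MemLp s ⊤ μ) (hrs : r ≤ᵐ[μ] s)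
    (u : Lp ℂ 2 μ) : (inner ℂ u (mulLp r hr u)).re ≤ (inner ℂ u (mulLp s hs u)).re := by
  have hre (v : Lp ℂ 2 μ) : (inner ℂ u v).re = ∫ x, (inner ℂ (u x) (v x)).re ∂μ := by
    rw [L2.inner_def]
    exact (integral_re (L2.integrable_inner (𝕜 := ℂ) u v)).symm
  have h_int (v : Lp ℂ 2 μ) : Integrable (fun x => (inner ℂ (u x) (v x)).re) μ :=
    (L2.integrable_inner (𝕜 := ℂ) u v).re
  rw [hre, hre]
  refine integral_mono_ae (h_int _) (h_int _) ?_
  filter_upwards [hrs, coeFn_mulLp hr u, coeFn_mulLp hs u] with x hx hru hsu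
  simp only [hru, hsu, RCLike.inner_apply, mul_assoc, Complex.mul_conj, ← Complex.ofReal_mul,
    Complex.ofReal_re]
  exact mul_le_mul_of_nonneg_right hx (Complex.normSq_nonneg _)

lemma mulLp_const (hc : MemLp (fun _ => c) ⊤ μ) (u : Lp ℂ 2 μ) :
    mulLp (fun _ => c) hc u = (c : ℂ) • u :=
  Lp.ext ((coeFn_mulLp hc u).trans (Lp.coeFn_smul (c : ℂ) u).symm)

lemma mulLp_mulLp_of_mul_eq_one (hr : MemLp r ⊤ μ) (hs : MemLp s ⊤ μ) (hrs : r * s =ᵐ[μ] 1)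
    (u : Lp ℂ 2 μ) : mulLp r hr (mulLp s hs u) = u := by
  refine Lp.ext ?_
  filter_upwards [hrs, coeFn_mulLp hr (mulLp s hs u), coeFn_mulLp hs u] with x hx hr hs
  rw [hr, hs, ← mul_assoc, ← Complex.ofReal_mul]
  simp_all

/-- Componentwise multiplication by the bounded real function `r` on `L²` fields. -/
def mulField (ι : Type*) [Fintype ι] (r : α → ℝ) (hr : MemLp r ⊤ μ) :
    PiLp 2 (fun _ : ι => Lp ℂ 2 μ) →L[ℂ] PiLp 2 (fun _ : ι => Lp ℂ 2 μ) :=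
  (PiLp.continuousLinearEquiv 2 ℂ fun _ : ι => Lp ℂ 2 μ).symm.toContinuousLinearMap.comp
    (.pi fun i => (mulLp r hr).comp (PiLp.proj 2 (𝕜 := ℂ) (fun _ : ι => Lp ℂ 2 μ) i))

lemma mulField_apply (hr : MemLp r ⊤ μ) (u : PiLp 2 fun _ : ι => Lp ℂ 2 μ) (i : ι) :
    mulField ι r hr u i = mulLp r hr (u i) := rfl

lemma inner_mulField_comm (hr : MemLp r ⊤ μ) (u v : PiLp 2 fun _ : ι => Lp ℂ 2 μ) :
    inner ℂ (mulField ι r hr u) v = inner ℂ u (mulField ι r hr v) := by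
  simp only [PiLp.inner_apply, mulField_apply, inner_mulLp_comm]

lemma re_inner_mulField_mono (hr : MemLp r ⊤ μ) (hs : MemLp s ⊤ μ) (hrs : r ≤ᵐ[μ] s)
    (u : PiLp 2 fun _ : ι => Lp ℂ 2 μ) :
    (inner ℂ u (mulField ι r hr u)).re ≤ (inner ℂ u (mulField ι s hs u)).re := by
  simp only [PiLp.inner_apply, mulField_apply, Complex.re_sum]
  exact Finset.sum_le_sum fun i _ => re_inner_mulLp_mono hr hs hrs (u i)

lemma re_inner_mulField_const (hc : MemLp (fun _ => c) ⊤ μ)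
    (u : PiLp 2 fun _ : ι => Lp ℂ 2 μ) :
    (inner ℂ u (mulField ι (fun _ => c) hc u)).re = c * ‖u‖ ^ 2 := by
  have hsmul : mulField ι (fun _ => c) hc u = (c : ℂ) • u :=
    PiLp.ext fun i => mulLp_const hc (u i)
  rw [hsmul, inner_smul_right, inner_self_eq_norm_sq_to_K]
  simp [← Complex.ofReal_pow]

lemma mul_norm_sq_le_re_inner_mulField [IsFiniteMeasure μ] (hr : MemLp r ⊤ μ)
    (hc : ∀ᵐ x ∂μ, c ≤ r x) (u : PiLp 2 fun _ : ι => Lp ℂ 2 μ) :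
    c * ‖u‖ ^ 2 ≤ (inner ℂ u (mulField ι r hr u)).re :=
  (re_inner_mulField_const (memLp_const c) u).symm.trans_le
    (re_inner_mulField_mono (memLp_const c) hr hc u)

lemma re_inner_mulField_le_mul_norm_sq [IsFiniteMeasure μ] (hr : MemLp r ⊤ μ)
    (hc : ∀ᵐ x ∂μ, r x ≤ c) (u : PiLp 2 fun _ : ι => Lp ℂ 2 μ) :
    (inner ℂ u (mulField ι r hr u)).re ≤ c * ‖u‖ ^ 2 :=
  (re_inner_mulField_mono hr (memLp_const c) hc u).trans_eq
    (re_inner_mulField_const (memLp_const c) u)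

/-- Componentwise multiplication by `r`, inverted by multiplication by `s`. -/
def mulFieldEquiv (ι : Type*) [Fintype ι] (hr : MemLp r ⊤ μ) (hs : MemLp s ⊤ μ)
    (hrs : r * s =ᵐ[μ] 1) :
    PiLp 2 (fun _ : ι => Lp ℂ 2 μ) ≃L[ℂ] PiLp 2 (fun _ : ι => Lp ℂ 2 μ) :=
  .equivOfInverse (mulField ι r hr) (mulField ι s hs)
    (fun u => PiLp.ext fun i => mulLp_mulLp_of_mul_eq_one hs hr (mul_comm r s ▸ hrs) (u i))
    (fun u => PiLp.ext fun i => mulLp_mulLp_of_mul_eq_one hr hs hrs (u i))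

end Multiplication

section Coercivity

variable {H : Type*} [NormedAddCommGroup H] [InnerProductSpace ℂ H]

lemma exists_mul_add_norm_sq_le (f : H →L[ℂ] H) {c d : ℝ} (hc : 0 < c) (hd : 0 < d) :
    ∃ δ > 0, ∀ a b : H, δ * (‖a‖ ^ 2 + ‖b‖ ^ 2) ≤ c * ‖b + f a‖ ^ 2 + d * ‖a‖ ^ 2 := by
  refine ⟨min (c / 2) (d / (1 + 2 * ‖f‖ ^ 2)), by positivity, fun a b => ?_⟩
  set δ := min (c / 2) (d / (1 + 2 * ‖f‖ ^ 2))
  have : 0 < δ := by positivity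
  have hδc : δ * 2 ≤ c := (le_div_iff₀ two_pos).1 (min_le_left _ _)
  have hδd : δ * (1 + 2 * ‖f‖ ^ 2) ≤ d := (le_div_iff₀ (by positivity)).1 (min_le_right _ _)
  have hb : ‖b‖ ^ 2 ≤ 2 * (‖b + f a‖ ^ 2 + ‖f‖ ^ 2 * ‖a‖ ^ 2) := by
    have htri : ‖b‖ ≤ ‖b + f a‖ + ‖f‖ * ‖a‖ := by
      simpa using (norm_sub_le (b + f a) (f a)).trans (add_le_add_right (f.le_opNorm a) _)
    calc ‖b‖ ^ 2 ≤ (‖b + f a‖ + ‖f‖ * ‖a‖) ^ 2 := by gcongr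
      _ ≤ 2 * (‖b + f a‖ ^ 2 + (‖f‖ * ‖a‖) ^ 2) := add_sq_le
      _ = 2 * (‖b + f a‖ ^ 2 + ‖f‖ ^ 2 * ‖a‖ ^ 2) := by ring
  calc δ * (‖a‖ ^ 2 + ‖b‖ ^ 2)
      ≤ δ * (‖a‖ ^ 2 + 2 * (‖b + f a‖ ^ 2 + ‖f‖ ^ 2 * ‖a‖ ^ 2)) := by gcongr
    _ = δ * 2 * ‖b + f a‖ ^ 2 + δ * (1 + 2 * ‖f‖ ^ 2) * ‖a‖ ^ 2 := by ring
    _ ≤ c * ‖b + f a‖ ^ 2 + d * ‖a‖ ^ 2 := by gcongr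

variable {K : Type*} [NormedAddCommGroup K] [InnerProductSpace ℂ K] {A L : K →L[ℂ] H}
  {X : Submodule ℂ K} {Q : H ≃L[ℂ] H} {s : ℝ}

lemma exists_mul_norm_sq_le_of_shift_le {B : K → ℝ} (f : H →L[ℂ] H) {c d κ : ℝ} (hκ : 0 < κ)
    (hgraph : ∀ g ∈ X, κ * ‖g‖ ^ 2 ≤ ‖A g‖ ^ 2 + ‖L g‖ ^ 2) (hc : 0 < c) (hd : 0 < d)
    (hB : ∀ g ∈ X, c * ‖L g + f (A g)‖ ^ 2 + d * ‖A g‖ ^ 2 ≤ B g) :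
    ∃ c > 0, ∀ g ∈ X, c * ‖g‖ ^ 2 ≤ B g := by
  obtain ⟨δ, hδ, hle⟩ := exists_mul_add_norm_sq_le f hc hd
  refine ⟨δ * κ, mul_pos hδ hκ, fun g hg => ?_⟩
  calc δ * κ * ‖g‖ ^ 2 = δ * (κ * ‖g‖ ^ 2) := mul_assoc ..
    _ ≤ δ * (‖A g‖ ^ 2 + ‖L g‖ ^ 2) := by gcongr; exact hgraph g hg
    _ ≤ B g := (hle _ _).trans (hB g hg)

/-- The Helmholtz-type operator `L + s`, where `A` embeds the domain of `L`. -/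
def shiftedOp (A L : K →L[ℂ] H) (s : ℝ) : K →L[ℂ] H := L + (s : ℂ) • A

/-- The operator `Q⁻¹ (L + s) + s`, which maps `u = U - V` to `-s V` for every solution `(U, V)`
of the transmission problem. -/
def reducedOp (A L : K →L[ℂ] H) (Q : H ≃L[ℂ] H) (s : ℝ) : K →L[ℂ] H :=
  Q.symm.toContinuousLinearMap.comp (shiftedOp A L s) + (s : ℂ) • A

lemma re_inner_add_smul_self (s : ℝ) (a b : H) :
    (inner ℂ a (b + (s : ℂ) • a)).re = (inner ℂ a b).re + s * ‖a‖ ^ 2 := by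
  rw [inner_add_right, inner_smul_right, inner_self_eq_norm_sq_to_K]
  simp [← Complex.ofReal_pow]

lemma shiftedOp_apply (u : K) : shiftedOp A L s u = L u + (s : ℂ) • A u := rfl

lemma reducedOp_apply (u : K) :
    reducedOp A L Q s u = Q.symm (shiftedOp A L s u) + (s : ℂ) • A u := rfl

lemma le_neg_re_inner_of_neg {c Λ : ℝ} (hs : 0 ≤ s)
    (hQ : ∀ a, c * ‖a‖ ^ 2 ≤ -(inner ℂ a (Q.symm a)).re) {g : K}
    (hΛ : Λ * ‖A g‖ ^ 2 ≤ -(inner ℂ (A g) (L g)).re) :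
    c * ‖shiftedOp A L s g‖ ^ 2 + s * (Λ - s) * ‖A g‖ ^ 2 ≤
      -(inner ℂ (shiftedOp A L s g) (reducedOp A L Q s g)).re := by
  have hsplit : (inner ℂ (shiftedOp A L s g) (reducedOp A L Q s g)).re =
      (inner ℂ (shiftedOp A L s g) (Q.symm (shiftedOp A L s g))).re +
        s * ((inner ℂ (A g) (L g)).re + s * ‖A g‖ ^ 2) := by
    rw [reducedOp_apply, inner_add_right, inner_smul_right, Complex.add_re,
      Complex.re_ofReal_mul, ← re_inner_add_smul_self]
    exact congrArg (_ + s * ·) (inner_re_symm (𝕜 := ℂ) _ _)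
  rw [hsplit]
  nlinarith [hQ (shiftedOp A L s g)]

lemma le_re_inner_of_pos {c Λ M : ℝ} (hs : 0 ≤ s)
    (hsymm : ∀ a b, inner ℂ (Q a) b = inner ℂ a (Q b))
    (hQ : ∀ a, c * ‖a‖ ^ 2 ≤ (inner ℂ a (Q.symm a)).re)
    (hM : ∀ a, (inner ℂ a (Q a)).re ≤ (M - 1) * ‖a‖ ^ 2) {g : K}
    (hΛ : Λ * ‖A g‖ ^ 2 ≤ -(inner ℂ (A g) (L g)).re) :
    c * ‖shiftedOp A L s g + (s : ℂ) • Q (A g)‖ ^ 2 + s * (Λ - s * M) * ‖A g‖ ^ 2 ≤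
      (inner ℂ (shiftedOp A L s g) (reducedOp A L Q s g)).re := by
  set y := shiftedOp A L s g + (s : ℂ) • Q (A g) with hy_def
  have hS : shiftedOp A L s g = y - (s : ℂ) • Q (A g) := (add_sub_cancel_right _ _).symm
  have hR : reducedOp A L Q s g = Q.symm y := by
    rw [reducedOp_apply, map_add, map_smul, Q.symm_apply_apply]
  have hsplit : (inner ℂ (shiftedOp A L s g) (reducedOp A L Q s g)).re =
      (inner ℂ y (Q.symm y)).re - s * (inner ℂ (A g) y).re := by
    rw [hS, hR, inner_sub_left, inner_smul_left, hsymm, Q.apply_symm_apply, Complex.conj_ofReal,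
      Complex.sub_re, Complex.re_ofReal_mul]
  have hy : (inner ℂ (A g) y).re =
      (inner ℂ (A g) (L g)).re + s * ‖A g‖ ^ 2 + s * (inner ℂ (A g) (Q (A g))).re := by
    rw [hy_def, shiftedOp_apply, inner_add_right, Complex.add_re, re_inner_add_smul_self,
      inner_smul_right, Complex.re_ofReal_mul]
  rw [hsplit, hy]
  nlinarith [hQ y, mul_le_mul_of_nonneg_left (hM (A g)) (mul_nonneg hs hs)]

theorem exists_mul_norm_sq_le_of_neg {c Λ κ : ℝ} (hs : 0 < s) (hc : 0 < c) (hκ : 0 < κ)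
    (hsΛ : s < Λ) (hQ : ∀ a, c * ‖a‖ ^ 2 ≤ -(inner ℂ a (Q.symm a)).re)
    (hΛ : ∀ g ∈ X, Λ * ‖A g‖ ^ 2 ≤ -(inner ℂ (A g) (L g)).re)
    (hgraph : ∀ g ∈ X, κ * ‖g‖ ^ 2 ≤ ‖A g‖ ^ 2 + ‖L g‖ ^ 2) :
    ∃ c > 0, ∀ g ∈ X,
      c * ‖g‖ ^ 2 ≤ ‖inner ℂ (shiftedOp A L s g) (reducedOp A L Q s g)‖ := by
  refine exists_mul_norm_sq_le_of_shift_le ((s : ℂ) • .id ℂ H) hκ hgraph hc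
    (mul_pos hs (sub_pos.2 hsΛ)) fun g hg => ?_
  change c * ‖shiftedOp A L s g‖ ^ 2 + s * (Λ - s) * ‖A g‖ ^ 2 ≤ _
  exact (le_neg_re_inner_of_neg hs.le hQ (hΛ g hg)).trans
    ((neg_le_abs _).trans (Complex.abs_re_le_norm _))

theorem exists_mul_norm_sq_le_of_pos {c Λ M κ : ℝ} (hs : 0 < s) (hc : 0 < c) (hκ : 0 < κ)
    (hsΛ : s * M < Λ) (hsymm : ∀ a b, inner ℂ (Q a) b = inner ℂ a (Q b))
    (hQ : ∀ a, c * ‖a‖ ^ 2 ≤ (inner ℂ a (Q.symm a)).re)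
    (hM : ∀ a, (inner ℂ a (Q a)).re ≤ (M - 1) * ‖a‖ ^ 2)
    (hΛ : ∀ g ∈ X, Λ * ‖A g‖ ^ 2 ≤ -(inner ℂ (A g) (L g)).re)
    (hgraph : ∀ g ∈ X, κ * ‖g‖ ^ 2 ≤ ‖A g‖ ^ 2 + ‖L g‖ ^ 2) :
    ∃ c > 0, ∀ g ∈ X,
      c * ‖g‖ ^ 2 ≤ ‖inner ℂ (shiftedOp A L s g) (reducedOp A L Q s g)‖ := by
  refine exists_mul_norm_sq_le_of_shift_le ((s : ℂ) • (.id ℂ H + Q.toContinuousLinearMap)) hκ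
    hgraph hc (mul_pos hs (sub_pos.2 hsΛ)) fun g hg => ?_
  have hshift : L g + ((s : ℂ) • (.id ℂ H + Q.toContinuousLinearMap)) (A g) =
      shiftedOp A L s g + (s : ℂ) • Q (A g) :=
    (congrArg (L g + ·) (smul_add _ _ _)).trans (add_assoc _ _ _).symm
  rw [hshift]
  exact (le_re_inner_of_pos hs.le hsymm hQ hM (hΛ g hg)).trans (Complex.re_le_norm _)

end Coercivity

section Reduction

variable {K H : Type*} [NormedAddCommGroup K] [InnerProductSpace ℂ K] [NormedAddCommGroup H]
  [InnerProductSpace ℂ H] {A L : K →L[ℂ] H} {X : Submodule ℂ K} {Q : H ≃L[ℂ] H} {s : ℝ}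

theorem lax_milgram_affine [CompleteSpace H] [CompleteSpace X]
    {S R : K →L[ℂ] H} {c : ℝ} (hc : 0 < c)
    (hcoer : ∀ g ∈ X, c * ‖g‖ ^ 2 ≤ ‖inner ℂ (S g) (R g)‖) :
    ∃ P : K →L[ℂ] K, ∀ u₀ u,
      (u - u₀ ∈ X ∧ ∀ g ∈ X, inner ℂ (S g) (R u) = 0) ↔ u = P u₀ := by
  let S' : H →L[ℂ] X := (S.comp X.subtypeL).adjoint
  let T : X →L[ℂ] X := S'.comp (R.comp X.subtypeL)
  have hS' (g : X) (q : H) : inner ℂ g (S' q) = inner ℂ (S g) q :=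
    ContinuousLinearMap.adjoint_inner_right _ g q
  have hT : IsUnit T :=
    ContinuousLinearMap.isUnit_of_forall_le_norm_inner_map T (c := ⟨c, hc.le⟩) hc fun g => by
      rw [norm_inner_symm]
      exact (mul_comm _ _).trans_le ((hcoer g g.2).trans_eq (congrArg _ (hS' g (R g)).symm))
  obtain ⟨E, hE⟩ : ∃ E : X ≃L[ℂ] X, ∀ w, E w = S' (R w) :=
    ⟨ContinuousLinearEquiv.unitsEquiv ℂ X hT.unit, fun _ => rfl⟩
  have horth (q : H) : (∀ g ∈ X, inner ℂ (S g) q = 0) ↔ S' q = 0 := by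
    refine ⟨fun h => ext_inner_left ℂ fun g => ?_, fun h g hg => ?_⟩
    · rw [hS', h g g.2, inner_zero_right]
    · rw [← hS' ⟨g, hg⟩ q, h, inner_zero_right]
  refine ⟨.id ℂ K - X.subtypeL.comp (E.symm.toContinuousLinearMap.comp (S'.comp R)),
    fun u₀ u => ?_⟩
  have hP (w : X) : u₀ + w = u₀ - E.symm (S' (R u₀)) ↔ S' (R (u₀ + w)) = 0 := by
    rw [sub_eq_add_neg, add_right_inj, ← Submodule.coe_neg, Subtype.coe_inj, ← map_neg,
      ContinuousLinearEquiv.eq_symm_apply, hE, map_add, map_add, add_eq_zero_iff_eq_neg']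
  rw [horth]
  constructor
  · rintro ⟨hu, h⟩
    rw [← add_sub_cancel u₀ u] at h ⊢
    exact (hP ⟨u - u₀, hu⟩).2 h
  · rintro rfl
    refine ⟨?_, ?_⟩
    · exact (sub_sub_cancel_left u₀ _).symm ▸ X.neg_mem (E.symm (S' (R u₀))).2
    · have h := (hP (-E.symm (S' (R u₀)))).1 (sub_eq_add_neg u₀ _).symm
      rwa [Submodule.coe_neg, ← sub_eq_add_neg] at h

/-- `L q = p` weakly: tested against all `g` in the space `X` of admissible test elements. -/
def SolvesWeakly (A L : K →L[ℂ] H) (X : Submodule ℂ K) (q p : H) : Prop :=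
  ∀ g ∈ X, inner ℂ (L g) q = inner ℂ (A g) p

lemma solvesWeakly_neg_smul_iff {v : H} :
    SolvesWeakly A L X v (-(s : ℂ) • v) ↔ ∀ g ∈ X, inner ℂ (shiftedOp A L s g) v = 0 := by
  refine forall₂_congr fun g _ => ?_
  rw [shiftedOp_apply, inner_add_left, inner_smul_left, inner_smul_right, Complex.conj_ofReal,
    neg_mul, add_eq_zero_iff_eq_neg]

lemma solvesWeakly_pair_iff (hsymm : ∀ u, SolvesWeakly A L X (A u) (L u))
    (hdense : ∀ x, (∀ g ∈ X, inner ℂ (A g) x = 0) → x = 0) {u : K} {U V : H}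
    (hu : A u = U - V) (hV : SolvesWeakly A L X V (-(s : ℂ) • V)) :
    SolvesWeakly A L X U (-(s : ℂ) • (U + Q U)) ↔ shiftedOp A L s u = -(s : ℂ) • Q U := by
  have hU : U = V + A u := by rw [hu, add_sub_cancel]
  have htest (g : K) (hg : g ∈ X) :
      inner ℂ (L g) U - inner ℂ (A g) (-(s : ℂ) • (U + Q U)) =
        inner ℂ (A g) (shiftedOp A L s u - -(s : ℂ) • Q U) := by
    nth_rw 1 [hU]
    rw [inner_add_right, hV g hg, hsymm u g hg, ← inner_add_right, ← inner_sub_right,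
      shiftedOp_apply, hu]
    congr 1
    module
  rw [← sub_eq_zero]
  exact ⟨fun h => hdense _ fun g hg => (htest g hg).symm.trans (sub_eq_zero.2 (h g hg)),
    fun h g hg => sub_eq_zero.1 ((htest g hg).trans (by rw [h, inner_zero_right]))⟩

theorem exists_solution_operators [CompleteSpace H] [CompleteSpace X] {c : ℝ} (hc : 0 < c)
    (hs : s ≠ 0)
    (hsymm : ∀ u, SolvesWeakly A L X (A u) (L u))
    (hdense : ∀ x, (∀ g ∈ X, inner ℂ (A g) x = 0) → x = 0)
    (hcoer : ∀ g ∈ X, c * ‖g‖ ^ 2 ≤ ‖inner ℂ (shiftedOp A L s g) (reducedOp A L Q s g)‖) :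
    ∃ 𝒰 𝒱 : K →L[ℂ] H, ∀ u₀ U V,
      (SolvesWeakly A L X U (-(s : ℂ) • (U + Q U)) ∧ SolvesWeakly A L X V (-(s : ℂ) • V) ∧
        ∃ u, u - u₀ ∈ X ∧ A u = U - V) ↔ U = 𝒰 u₀ ∧ V = 𝒱 u₀ := by
  obtain ⟨P, hP⟩ := lax_milgram_affine hc hcoer
  have hs' : (-(s : ℂ)) ≠ 0 := neg_ne_zero.2 (Complex.ofReal_ne_zero.2 hs)
  let 𝒰 : K →L[ℂ] H := (-(s : ℂ))⁻¹ • Q.symm.toContinuousLinearMap.comp (shiftedOp A L s)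
  let 𝒱 : K →L[ℂ] H := (-(s : ℂ))⁻¹ • reducedOp A L Q s
  have h𝒰 (u : K) (U : H) : shiftedOp A L s u = -(s : ℂ) • Q U ↔ U = 𝒰 u := by
    change _ ↔ U = (-(s : ℂ))⁻¹ • Q.symm (shiftedOp A L s u)
    rw [eq_inv_smul_iff₀ hs', ContinuousLinearEquiv.eq_symm_apply, map_smul, eq_comm]
  have h𝒱 (u : K) : A u = 𝒰 u - 𝒱 u := by
    change _ = (-(s : ℂ))⁻¹ • Q.symm (shiftedOp A L s u) - (-(s : ℂ))⁻¹ • reducedOp A L Q s u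
    rw [← smul_sub, reducedOp_apply, sub_add_cancel_left, ← neg_smul, inv_smul_smul₀ hs']
  have hzero (u : K) : SolvesWeakly A L X (𝒱 u) (-(s : ℂ) • 𝒱 u) ↔
      ∀ g ∈ X, inner ℂ (shiftedOp A L s g) (reducedOp A L Q s u) = 0 := by
    rw [solvesWeakly_neg_smul_iff]
    refine forall₂_congr fun g _ => ?_
    change inner ℂ _ ((-(s : ℂ))⁻¹ • reducedOp A L Q s u) = 0 ↔ _
    rw [inner_smul_right, mul_eq_zero_iff_left (inv_ne_zero hs')]
  refine ⟨𝒰.comp P, 𝒱.comp P, fun u₀ U V => ⟨?_, ?_⟩⟩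
  · rintro ⟨hU, hV, u, hu, huUV⟩
    obtain rfl : U = 𝒰 u := (h𝒰 u U).1 ((solvesWeakly_pair_iff hsymm hdense huUV hV).1 hU)
    obtain rfl : V = 𝒱 u := sub_right_injective (huUV.symm.trans (h𝒱 u))
    obtain rfl : u = P u₀ := (hP u₀ u).1 ⟨hu, (hzero u).1 hV⟩
    exact ⟨rfl, rfl⟩
  · rintro ⟨rfl, rfl⟩
    obtain ⟨hu, horth⟩ := (hP u₀ (P u₀)).2 rfl
    have hV := (hzero (P u₀)).2 horth
    exact ⟨(solvesWeakly_pair_iff hsymm hdense (h𝒱 _) hV).2 ((h𝒰 _ _).2 rfl), hV, _, hu, h𝒱 _⟩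

lemma exists_norm_add_norm_le (A B : K →L[ℂ] H) : ∃ C > 0, ∀ u, ‖A u‖ + ‖B u‖ ≤ C * ‖u‖ := by
  refine ⟨‖A‖ + ‖B‖ + 1, by positivity, fun u => ?_⟩
  calc ‖A u‖ + ‖B u‖ ≤ ‖A‖ * ‖u‖ + ‖B‖ * ‖u‖ := add_le_add (A.le_opNorm u) (B.le_opNorm u)
    _ ≤ (‖A‖ + ‖B‖ + 1) * ‖u‖ := by linarith [norm_nonneg u]

end Reduction

section TransmissionProblem

variable {Ω : Opens E3} {lam mu : ℝ}

lemma eq_zero_of_pairing_eq_zero {u : L2 Ω} (h : ∀ φ : 𝓓(Ω, ℂ), pairing u φ = 0) : u = 0 := by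
  have hloc : LocallyIntegrable u (volume.restrict (Ω : Set E3)) :=
    (Lp.memLp u).locallyIntegrable one_le_two
  have hzero := Ω.isOpen.ae_eq_zero_of_integral_contDiff_smul_eq_zero
    (hloc.locallyIntegrableOn Ω) fun g hg hgc hgΩ => by
      let φ : 𝓓(Ω, ℂ) := ⟨fun x => (g x : ℂ), Complex.ofRealCLM.contDiff.comp hg,
        hgc.comp_left Complex.ofReal_zero,
        (tsupport_comp_subset Complex.ofReal_zero g).trans hgΩ⟩
      refine Eq.trans (integral_congr_ae (.of_forall fun x => ?_)) (h φ)
      exact mul_comm (g x : ℂ) (u x)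
  refine Lp.ext (.trans ?_ (Lp.coeFn_zero _ _ _).symm)
  filter_upwards [hzero, ae_restrict_mem Ω.isOpen.measurableSet] with x hx hxΩ using hx hxΩ

lemma eq_zero_of_inner_testField_eq_zero {u : L2v Ω}
    (h : ∀ Φ : Fin 3 → 𝓓(Ω, ℂ), inner ℂ (testField Φ) u = 0) : u = 0 := by
  refine PiLp.ext fun i => eq_zero_of_pairing_eq_zero fun φ => ?_
  have hi := h fun k => conjTest ((Pi.single i φ : Fin 3 → 𝓓(Ω, ℂ)) k)
  rw [inner_testField, Fintype.sum_eq_single i fun k hk => by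
    rw [conjTest_involutive, Pi.single_eq_of_ne hk, map_zero]] at hi
  rwa [conjTest_involutive, Pi.single_eq_same] at hi

lemma eq_zero_of_inner_zeroData_eq_zero {x : L2v Ω}
    (h : ∀ g ∈ zeroData Ω lam mu, inner ℂ (HLame.fnL g) x = 0) : x = 0 :=
  eq_zero_of_inner_testField_eq_zero fun Φ => h (testHLame lam mu Φ) (testHLame_mem_zeroData Φ)

/-- The weak equation `Δ* q = p`, tested against the fields with vanishing Cauchy data. -/
def SolvesLame (lam mu : ℝ) (q p : L2v Ω) : Prop :=
  SolvesWeakly (K := HLame Ω lam mu) HLame.fnL HLame.lameL (zeroData Ω lam mu) q p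

theorem isWeakLame_iff_solvesLame (hbdd : Bornology.IsBounded (Ω : Set E3))
    (hΩ : HasSegmentProperty (Ω : Set E3)) {q p : L2v Ω} {p' : Fin 3 → E3 → ℂ}
    (hp : ∀ i, p' i =ᵐ[volume.restrict (Ω : Set E3)] p i) :
    IsWeakLame lam mu q p' ↔ SolvesLame lam mu q p := by
  rw [isWeakLame_iff_inner hp]
  refine ⟨fun h g hg => ?_, fun h Φ => h (testHLame lam mu Φ) (testHLame_mem_zeroData Φ)⟩
  have hclosed : IsClosed {z : L2v Ω × L2v Ω | inner ℂ z.2 q = inner ℂ z.1 p} :=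
    isClosed_eq (by fun_prop) (by fun_prop)
  obtain ⟨hg₀, hg₁⟩ := mem_zeroData.1 hg
  have hmem := closure_minimal (Set.range_subset_iff.2 h) hclosed
    (mem_closure_range_testField hbdd hΩ hg₀ hg₁)
  exact hmem

variable {ρ : E3 → ℝ} {ω : ℝ}

lemma coe_neg_smul_add_mulField_ae_eq (hρ : MemLp (ρ - 1) ⊤ (volume.restrict (Ω : Set E3)))
    (U : L2v Ω) (i : Fin 3) :
    (fun x => (-(ω ^ 2 * ρ x : ℝ) : ℂ) * U i x) =ᵐ[volume.restrict (Ω : Set E3)]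
      (-((ω ^ 2 : ℝ) : ℂ) • (U + mulField (Fin 3) (ρ - 1) hρ U)) i := by
  filter_upwards [Lp.coeFn_smul (-((ω ^ 2 : ℝ) : ℂ)) ((U + mulField (Fin 3) (ρ - 1) hρ U) i),
    Lp.coeFn_add (U i) (mulLp (ρ - 1) hρ (U i)), coeFn_mulLp hρ (U i)] with x hsmul hadd hmul
  refine Eq.trans ?_ hsmul.symm
  rw [Pi.smul_apply, PiLp.add_apply, mulField_apply, hadd, Pi.add_apply, hmul]
  simp only [Complex.ofReal_mul, Complex.ofReal_pow, neg_mul, Pi.sub_apply, Pi.one_apply,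
    Complex.ofReal_sub, Complex.ofReal_one, smul_eq_mul, neg_inj]
  ring

lemma isITPSolution_iff (hbdd : Bornology.IsBounded (Ω : Set E3))
    (hΩ : HasSegmentProperty (Ω : Set E3))
    (hρ : MemLp (ρ - 1) ⊤ (volume.restrict (Ω : Set E3))) {u₀ : HLame Ω lam mu} {U V : L2v Ω} :
    IsITPSolution Ω lam mu ω ρ (trace0 (HLame.toH1v u₀)) (trace1 u₀) U V ↔
      SolvesLame lam mu U (-((ω ^ 2 : ℝ) : ℂ) • (U + mulField (Fin 3) (ρ - 1) hρ U)) ∧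
      SolvesLame lam mu V (-((ω ^ 2 : ℝ) : ℂ) • V) ∧
      ∃ u, u - u₀ ∈ zeroData Ω lam mu ∧ HLame.fnL u = U - V := by
  rw [← isWeakLame_iff_solvesLame hbdd hΩ (coe_neg_smul_add_mulField_ae_eq hρ U),
    ← isWeakLame_iff_solvesLame hbdd hΩ fun i =>
      (Lp.coeFn_smul (-((ω ^ 2 : ℝ) : ℂ)) (V i)).symm]
  simp only [sub_mem_zeroData_iff]
  constructor
  · rintro ⟨hU, hV, u, hu, htrace⟩
    exact ⟨hU, hV, u, htrace, hu⟩
  · rintro ⟨hU, hV, u, htrace, hu⟩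
    exact ⟨hU, hV, u, hu, htrace⟩

end TransmissionProblem

section BoundedMultipliers

variable {α : Type*} [MeasurableSpace α] {μ : Measure α} {r : α → ℝ}

lemma ae_essInf_le_and_le_essSup (hr : MemLp r ⊤ μ) :
    ∀ᵐ x ∂μ, essInf r μ ≤ r x ∧ r x ≤ essSup r μ := by
  have hbound : ∀ᵐ x ∂μ, |r x| ≤ (eLpNormEssSup r μ).toReal := by
    filter_upwards [enorm_ae_le_eLpNormEssSup r μ] with x hx
    rw [← Real.norm_eq_abs, ← toReal_enorm]
    exact ENNReal.toReal_mono (eLpNorm_exponent_top (f := r) ▸ hr.2).ne hx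
  have hge : (ae μ).IsBoundedUnder (· ≥ ·) r :=
    Filter.isBoundedUnder_of_eventually_ge (hbound.mono fun x hx => (abs_le.1 hx).1)
  have hle : (ae μ).IsBoundedUnder (· ≤ ·) r :=
    Filter.isBoundedUnder_of_eventually_le (hbound.mono fun x hx => (abs_le.1 hx).2)
  exact (ae_essInf_le hge).and (ae_le_essSup hle)

lemma memLp_top_inv {d : ℝ} (hr : AEMeasurable r μ) (hd : 0 < d) (h : ∀ᵐ x ∂μ, d ≤ |r x|) :
    MemLp r⁻¹ ⊤ μ := by
  refine memLp_top_of_bound hr.inv.aestronglyMeasurable d⁻¹ ?_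
  filter_upwards [h] with x hx
  rw [Pi.inv_apply, norm_inv, Real.norm_eq_abs]
  exact inv_anti₀ hd hx

lemma mul_inv_ae_eq_one {d : ℝ} (hd : 0 < d) (h : ∀ᵐ x ∂μ, d ≤ |r x|) : r * r⁻¹ =ᵐ[μ] 1 := by
  filter_upwards [h] with x hx
  exact mul_inv_cancel₀ (abs_pos.1 (hd.trans_le hx))

end BoundedMultipliers

section Coercive

variable {Ω : Opens E3} {lam mu s a b : ℝ} {r : E3 → ℝ}

theorem exists_mul_norm_sq_le_zeroData_of_pos [IsFiniteMeasure (volume.restrict (Ω : Set E3))]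
    (hmu : 0 < mu) (hlam : 0 < 3 * lam + 2 * mu) (hs : 0 < s)
    (hr : MemLp r ⊤ (volume.restrict (Ω : Set E3)))
    (hr' : MemLp r⁻¹ ⊤ (volume.restrict (Ω : Set E3)))
    (hrr : r * r⁻¹ =ᵐ[volume.restrict (Ω : Set E3)] 1)
    (h : ∀ᵐ x ∂volume.restrict (Ω : Set E3), 0 < r x ∧ r x ≤ b)
    (hsmall : s * (1 + b) < min mu (3 * lam + 2 * mu) * dirichletEigenvalue Ω) :
    ∃ c > 0, ∀ g ∈ zeroData Ω lam mu, c * ‖g‖ ^ 2 ≤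
      ‖inner ℂ (shiftedOp HLame.fnL HLame.lameL s g)
        (reducedOp HLame.fnL HLame.lameL (mulFieldEquiv (Fin 3) hr hr' hrr) s g)‖ := by
  have hgraph := exists_mul_norm_sq_le_of_mem_zeroData (Ω := Ω) hmu hlam
  obtain ⟨κ, hκ, hgraph⟩ := hgraph
  have hinv : ∀ᵐ x ∂volume.restrict (Ω : Set E3), (1 + |b|)⁻¹ ≤ r⁻¹ x := by
    filter_upwards [h] with x ⟨hx, hxb⟩
    exact inv_anti₀ hx (by linarith [le_abs_self b])
  refine exists_mul_norm_sq_le_of_pos (K := HLame Ω lam mu) (c := (1 + |b|)⁻¹) hs (by positivity)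
    hκ hsmall (inner_mulField_comm hr) (mul_norm_sq_le_re_inner_mulField hr' hinv) ?_ ?_ ?_
  · rw [add_sub_cancel_left]
    exact re_inner_mulField_le_mul_norm_sq hr (h.mono fun x hx => hx.2)
  · intro g hg
    exact poincare_zeroData hmu hlam.le hg
  · intro g hg
    exact hgraph g hg

theorem exists_mul_norm_sq_le_zeroData_of_neg [IsFiniteMeasure (volume.restrict (Ω : Set E3))]
    (hmu : 0 < mu) (hlam : 0 < 3 * lam + 2 * mu) (hs : 0 < s)
    (hr : MemLp r ⊤ (volume.restrict (Ω : Set E3)))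
    (hr' : MemLp r⁻¹ ⊤ (volume.restrict (Ω : Set E3)))
    (hrr : r * r⁻¹ =ᵐ[volume.restrict (Ω : Set E3)] 1)
    (h : ∀ᵐ x ∂volume.restrict (Ω : Set E3), a ≤ r x ∧ r x < 0)
    (hsmall : s < min mu (3 * lam + 2 * mu) * dirichletEigenvalue Ω) :
    ∃ c > 0, ∀ g ∈ zeroData Ω lam mu, c * ‖g‖ ^ 2 ≤
      ‖inner ℂ (shiftedOp HLame.fnL HLame.lameL s g)
        (reducedOp HLame.fnL HLame.lameL (mulFieldEquiv (Fin 3) hr hr' hrr) s g)‖ := by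
  have hgraph := exists_mul_norm_sq_le_of_mem_zeroData (Ω := Ω) hmu hlam
  obtain ⟨κ, hκ, hgraph⟩ := hgraph
  have hinv : ∀ᵐ x ∂volume.restrict (Ω : Set E3), r⁻¹ x ≤ -(1 + |a|)⁻¹ := by
    filter_upwards [h] with x ⟨hax, hx⟩
    rw [Pi.inv_apply, le_neg, ← inv_neg]
    exact inv_anti₀ (neg_pos.2 hx) (by linarith [neg_abs_le a])
  refine exists_mul_norm_sq_le_of_neg (K := HLame Ω lam mu) (c := (1 + |a|)⁻¹) hs (by positivity)
    hκ hsmall ?_ ?_ ?_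
  · intro u
    rw [le_neg, ← neg_mul]
    exact re_inner_mulField_le_mul_norm_sq hr' hinv u
  · intro g hg
    exact poincare_zeroData hmu hlam.le hg
  · intro g hg
    exact hgraph g hg

end Coercive

section Solvability

variable {Ω : Opens E3} {lam mu ω : ℝ} {ρ : E3 → ℝ}

lemma exists_pos_le_abs_sub_one {α : Type*} [MeasurableSpace α] {μ : Measure α} {ρ : α → ℝ}
    (hρ : MemLp ρ ⊤ μ) (hcontrast : 1 < essInf ρ μ ∨ essSup ρ μ < 1) :
    ∃ d > 0, ∀ᵐ x ∂μ, d ≤ |(ρ - 1) x| := by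
  rcases hcontrast with h | h
  · refine ⟨essInf ρ μ - 1, sub_pos.2 h, ?_⟩
    filter_upwards [ae_essInf_le_and_le_essSup hρ] with x hx
    exact (sub_le_sub_right hx.1 1).trans (le_abs_self _)
  · refine ⟨1 - essSup ρ μ, sub_pos.2 h, ?_⟩
    filter_upwards [ae_essInf_le_and_le_essSup hρ] with x hx
    exact (sub_le_sub_left hx.2 1).trans ((neg_sub _ _).symm.trans_le (neg_le_abs _))

theorem exists_mul_norm_sq_le_zeroData [IsFiniteMeasure (volume.restrict (Ω : Set E3))]
    (hmu : 0 < mu) (hlam : 0 < 3 * lam + 2 * mu)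
    (hρ : MemLp ρ ⊤ (volume.restrict (Ω : Set E3)))
    (hcontrast : 1 < essInf ρ (volume.restrict (Ω : Set E3)) ∨
      essSup ρ (volume.restrict (Ω : Set E3)) < 1) (hω : ω ≠ 0)
    (hsmall : ω ^ 2 * max 1 (essSup ρ (volume.restrict (Ω : Set E3))) <
      min mu (3 * lam + 2 * mu) * dirichletEigenvalue Ω)
    (hr : MemLp (ρ - 1) ⊤ (volume.restrict (Ω : Set E3)))
    (hr' : MemLp (ρ - 1)⁻¹ ⊤ (volume.restrict (Ω : Set E3)))
    (hrr : (ρ - 1) * (ρ - 1)⁻¹ =ᵐ[volume.restrict (Ω : Set E3)] 1) :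
    ∃ c > 0, ∀ g ∈ zeroData Ω lam mu, c * ‖g‖ ^ 2 ≤
      ‖inner ℂ (shiftedOp HLame.fnL HLame.lameL (ω ^ 2) g)
        (reducedOp HLame.fnL HLame.lameL (mulFieldEquiv (Fin 3) hr hr' hrr) (ω ^ 2) g)‖ := by
  have hbounds := ae_essInf_le_and_le_essSup hρ
  rcases hcontrast with h | h
  · refine exists_mul_norm_sq_le_zeroData_of_pos hmu hlam (sq_pos_of_ne_zero hω) hr hr' hrr
      (hbounds.mono fun x hx => ⟨sub_pos.2 (h.trans_le hx.1),
        sub_le_sub_right (hx.2.trans (le_max_right 1 _)) 1⟩) ?_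
    rwa [add_sub_cancel]
  · rw [max_eq_left h.le, mul_one] at hsmall
    exact exists_mul_norm_sq_le_zeroData_of_neg hmu hlam (sq_pos_of_ne_zero hω) hr hr' hrr
      (hbounds.mono fun x hx => ⟨sub_le_sub_right hx.1 1, sub_neg.2 (hx.2.trans_lt h)⟩) hsmall

lemma solvesLame_fnL_lameL (hbdd : Bornology.IsBounded (Ω : Set E3))
    (hΩ : HasSegmentProperty (Ω : Set E3)) (u : HLame Ω lam mu) :
    SolvesLame lam mu (HLame.fnL u) (HLame.lameL u) :=
  (isWeakLame_iff_solvesLame hbdd hΩ fun _ => ae_eq_rfl).1 u.2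

theorem exists_isITPSolution_iff_and_norm_add_norm_le (hbdd : Bornology.IsBounded (Ω : Set E3))
    (hΩ : HasSegmentProperty (Ω : Set E3)) (hmu : 0 < mu) (hlam : 0 < 3 * lam + 2 * mu)
    (hρ : MemLp ρ ⊤ (volume.restrict (Ω : Set E3)))
    (hcontrast : 1 < essInf ρ (volume.restrict (Ω : Set E3)) ∨
      essSup ρ (volume.restrict (Ω : Set E3)) < 1) (hω : ω ≠ 0)
    (hsmall : ω ^ 2 * max 1 (essSup ρ (volume.restrict (Ω : Set E3))) <
      min mu (3 * lam + 2 * mu) * dirichletEigenvalue Ω) :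
    ∃ 𝒰 𝒱 : HLame Ω lam mu → L2v Ω,
      (∀ u₀ U V, IsITPSolution Ω lam mu ω ρ (trace0 (HLame.toH1v u₀)) (trace1 u₀) U V ↔
        U = 𝒰 u₀ ∧ V = 𝒱 u₀) ∧
      ∃ C > 0, ∀ u₀, ‖𝒰 u₀‖ + ‖𝒱 u₀‖ ≤ C * ‖u₀‖ := by
  have : IsFiniteMeasure (volume.restrict (Ω : Set E3)) :=
    isFiniteMeasure_restrict.2 hbdd.measure_lt_top.ne
  obtain ⟨d, hd, hd_le⟩ := exists_pos_le_abs_sub_one hρ hcontrast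
  have hr : MemLp (ρ - 1) ⊤ (volume.restrict (Ω : Set E3)) := hρ.sub (memLp_const 1)
  have hr' := memLp_top_inv hr.aestronglyMeasurable.aemeasurable hd hd_le
  have hcoer := exists_mul_norm_sq_le_zeroData hmu hlam hρ hcontrast hω hsmall hr hr'
    (mul_inv_ae_eq_one hd hd_le)
  obtain ⟨c, hc, hcoer⟩ := hcoer
  have hops := exists_solution_operators (K := HLame Ω lam mu) hc (pow_ne_zero 2 hω)
    (solvesLame_fnL_lameL hbdd hΩ) (fun x => eq_zero_of_inner_zeroData_eq_zero) hcoer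
  obtain ⟨𝒰, 𝒱, hops⟩ := hops
  exact ⟨𝒰, 𝒱, fun u₀ U V => (isITPSolution_iff hbdd hΩ hr).trans (hops u₀ U V),
    exists_norm_add_norm_le 𝒰 𝒱⟩

end Solvability

end Elastic

end

theorem mainTheorem7_general
    (Ω : TopologicalSpace.Opens Elastic.E3)
    (hΩ_bdd : Bornology.IsBounded (Ω : Set Elastic.E3))
    (hΩ : Elastic.HasSegmentProperty (Ω : Set Elastic.E3))
    (lam mu : ℝ) (hmu : 0 < mu) (hlam : 0 < 3 * lam + 2 * mu)
    (ρ : Elastic.E3 → ℝ)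
    (hρ_bdd : MeasureTheory.MemLp ρ ⊤ (MeasureTheory.volume.restrict (Ω : Set Elastic.E3)))
    (hcontrast : 1 < essInf ρ (MeasureTheory.volume.restrict (Ω : Set Elastic.E3)) ∨
      essSup ρ (MeasureTheory.volume.restrict (Ω : Set Elastic.E3)) < 1)
    (ω : ℝ) (hω : ω ≠ 0)
    (hsmall : ω ^ 2 * max 1 (essSup ρ (MeasureTheory.volume.restrict (Ω : Set Elastic.E3))) <
      min mu (3 * lam + 2 * mu) * Elastic.dirichletEigenvalue Ω) :
    ∃ C : ℝ, 0 < C ∧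
      ∀ (f : Fin 3 → Elastic.HHalf Ω) (h : Fin 3 → Elastic.HMinusHalf Ω)
        (u₀ : Elastic.HLame Ω lam mu),
        Elastic.trace0 (Elastic.HLame.toH1v u₀) = f → Elastic.trace1 u₀ = h →
        (∃! p : Elastic.L2v Ω × Elastic.L2v Ω,
          Elastic.IsITPSolution Ω lam mu ω ρ f h p.1 p.2) ∧
        ∀ U V : Elastic.L2v Ω, Elastic.IsITPSolution Ω lam mu ω ρ f h U V →
          ‖U‖ + ‖V‖ ≤ C * ‖u₀‖ := by
  obtain ⟨𝒰, 𝒱, hsol, C, hC, hbound⟩ := Elastic.exists_isITPSolution_iff_and_norm_add_norm_le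
    hΩ_bdd hΩ hmu hlam hρ_bdd hcontrast hω hsmall
  refine ⟨C, hC, ?_⟩
  rintro f h u₀ rfl rfl
  refine ⟨⟨(𝒰 u₀, 𝒱 u₀), (hsol u₀ _ _).2 ⟨rfl, rfl⟩, fun p hp => ?_⟩, fun U V hUV => ?_⟩
  · exact Prod.ext ((hsol u₀ _ _).1 hp).1 ((hsol u₀ _ _).1 hp).2
  · obtain ⟨rfl, rfl⟩ := (hsol u₀ U V).1 hUV
    exact hbound u₀

theorem mainTheorem7
    (Ω : TopologicalSpace.Opens Elastic.E3)
    (hΩ_conn : IsConnected (Ω : Set Elastic.E3))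
    (hΩ_bdd : Bornology.IsBounded (Ω : Set Elastic.E3))
    (hΩ_C2 : Elastic.HasC2Boundary Ω)
    (lam mu : ℝ) (hmu : 0 < mu) (hlam : 0 < 3 * lam + 2 * mu)
    (ρ : Elastic.E3 → ℝ)
    (hρ_bdd : MeasureTheory.MemLp ρ ⊤ (MeasureTheory.volume.restrict (Ω : Set Elastic.E3)))
    (hρ_pos : ∀ x ∈ Ω, 0 < ρ x)
    (ρlow ρup : ℝ)
    (hρlow : ρlow = essInf ρ (MeasureTheory.volume.restrict (Ω : Set Elastic.E3)))
    (hρup : ρup = essSup ρ (MeasureTheory.volume.restrict (Ω : Set Elastic.E3)))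
    (hcontrast : 1 < ρlow ∨ ρup < 1)
    (ω : ℝ) (hω : ω ≠ 0)
    (m : ℝ) (hm : m = min mu (3 * lam + 2 * mu))
    (hsmall : ω ^ 2 < min (m * Elastic.dirichletEigenvalue Ω / ρup)
      (m * Elastic.dirichletEigenvalue Ω)) :
    ∃ C : ℝ, 0 < C ∧
      ∀ (f : Fin 3 → Elastic.HHalf Ω) (h : Fin 3 → Elastic.HMinusHalf Ω)
        (u₀ : Elastic.HLame Ω lam mu),
        Elastic.trace0 (Elastic.HLame.toH1v u₀) = f → Elastic.trace1 u₀ = h →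
        (∃! p : Elastic.L2v Ω × Elastic.L2v Ω,
          Elastic.IsITPSolution Ω lam mu ω ρ f h p.1 p.2) ∧
        ∀ U V : Elastic.L2v Ω, Elastic.IsITPSolution Ω lam mu ω ρ f h U V →
          ‖U‖ + ‖V‖ ≤ C * ‖u₀‖ := by
  subst hρlow hρup hm
  obtain ⟨hsmall_ρ, hsmall_one⟩ := lt_min_iff.1 hsmall
  refine mainTheorem7_general Ω hΩ_bdd hΩ_C2.hasSegmentProperty lam mu hmu hlam ρ hρ_bdd hcontrast
    ω hω ?_
  rcases max_cases 1 (essSup ρ (MeasureTheory.volume.restrict (Ω : Set Elastic.E3))) with h | h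
  · rwa [h.1, mul_one]
  · rw [h.1]
    exact (lt_div_iff₀ (one_pos.trans h.2)).1 hsmall_ρ
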